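/- There are $n$ advertisers and $k$ slots. An allocation is a partial matching between advertisers and slots: each slot is given to at most one advertiser and each advertiser gets at most one slot (slots and advertisers may stay unmatched). An outcome consists of the allocation together with the information which advertisers receive a click and which receive a purchase; for every allocation $A$ a probability distribution on the outcomes with allocation $A$ is given. An event $E$ is a set of outcomes; $E$ is $m$-dependent if there is a set of at most $m$ advertisers such that $\Pr[E\mid A]$ depends only on the placements of these advertisers in $A$. Each advertiser submits an OR-bid, i.e. a finite list of rows "pay $d$ for $E$" with $d\ge 0$ rational and $E$ an event; in an outcome the advertisers pay the sum of the amounts $d$ over all rows whose event is true. The winner determination problem is to find an allocation that maximizes the expected total payment. An instance in which all events are $1$-dependent is presented to the algorithm as a list of the slots and, for each advertiser, the list of rows, where a row consists of the amount $d$, the label of an advertiser $i$ on whose placement alone the probability of $E$ depends, and the probabilities (rational numbers, in binary) of $E$ for each of the $k+1$ possible placements of $i$ (slot $1,\dots,k$, or no slot). **Theorem.** For OR-bids all of whose events are $1$-dependent, winner determination is solvable in polynomial time: there are one algorithm (a program for a random access machine with logarithmic cost) and one polynomial $T$ such that on every such instance the algorithm outputs an allocation with maximum expected revenue, in time at most $T(s)$,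 where $s$ is the bit size of the input. -/

import Mathlib

/-! ### Random access machine with logarithmic cost

The model of computation: structured programs over an unbounded random access memory of natural
numbers. Every elementary operation is charged one unit plus the bit length of the number it
produces; as the operands are themselves produced by charged operations (and addresses are
operands), this is the logarithmic cost criterion, under which polynomial time is the same as
polynomial time on Turing machines. -/

namespace RAM

/-- The memory: finitely many banks (those that a program mentions), each an unbounded array of
natural numbers; `M b a` is the word at address `a` of bank `b`. -/
abbrev Mem : Type := ℕ → ℕ → ℕ

/-- Expressions: constants, memory reads at a computed address, and arithmetic on natural numbers
(truncated subtraction, integer division). -/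
inductive Expr : Type
  | lit (c : ℕ)
  | get (bank : ℕ) (addr : Expr)
  | add (x y : Expr)
  | sub (x y : Expr)
  | mul (x y : Expr)
  | div (x y : Expr)

/-- The value of an expression. -/
def Expr.val (M : Mem) : Expr → ℕ
  | lit c => c
  | get b a => M b (a.val M)
  | add x y => x.val M + y.val M
  | sub x y => x.val M - y.val M
  | mul x y => x.val M * y.val M
  | div x y => x.val M / y.val M

/-- The cost of evaluating an expression: one unit plus the bit length of the value, at each of its
nodes. -/
def Expr.cost (M : Mem) : Expr → ℕ
  | lit c => 1 + Nat.size c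
  | get b a => a.cost M + (1 + Nat.size (M b (a.val M)))
  | add x y => x.cost M + y.cost M + (1 + Nat.size (x.val M + y.val M))
  | sub x y => x.cost M + y.cost M + (1 + Nat.size (x.val M - y.val M))
  | mul x y => x.cost M + y.cost M + (1 + Nat.size (x.val M * y.val M))
  | div x y => x.cost M + y.cost M + (1 + Nat.size (x.val M / y.val M))

/-- Programs. Conditionals and loops test whether an expression is nonzero. -/
inductive Prog : Type
  | skip
  | set (bank : ℕ) (addr value : Expr)
  | seq (p q : Prog)
  | ite (test : Expr) (p q : Prog)
  | loop (test : Expr) (body : Prog)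

/-- Overwrite the word at address `a` of bank `b`. -/
def Mem.write (M : Mem) (b a v : ℕ) : Mem :=
  Function.update M b (Function.update (M b) a v)

/-- `Run p M M' t`: started on memory `M`, the program `p` halts with memory `M'`, at total
cost `t`. -/
inductive Run : Prog → Mem → Mem → ℕ → Prop
  | skip (M : Mem) : Run .skip M M 1
  | set (M : Mem) (b : ℕ) (a e : Expr) :
      Run (.set b a e) M (M.write b (a.val M) (e.val M)) (a.cost M + e.cost M + 1)
  | seq {p q : Prog} {M M' M'' : Mem} {t t' : ℕ} :
      Run p M M' t → Run q M' M'' t' → Run (.seq p q) M M'' (t + t' + 1)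
  | ite_true {e : Expr} {p q : Prog} {M M' : Mem} {t : ℕ} :
      e.val M ≠ 0 → Run p M M' t → Run (.ite e p q) M M' (e.cost M + t + 1)
  | ite_false {e : Expr} {p q : Prog} {M M' : Mem} {t : ℕ} :
      e.val M = 0 → Run q M M' t → Run (.ite e p q) M M' (e.cost M + t + 1)
  | loop_stop {e : Expr} {p : Prog} {M : Mem} :
      e.val M = 0 → Run (.loop e p) M M (e.cost M + 1)
  | loop_step {e : Expr} {p : Prog} {M M' M'' : Mem} {t t' : ℕ} :
      e.val M ≠ 0 → Run p M M' t → Run (.loop e p) M' M'' t' →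
      Run (.loop e p) M M'' (e.cost M + t + t' + 1)

/-- The initial memory: bank `0` holds the input words, every other word is `0`. -/
def initMem (w : List ℕ) : Mem := fun b a => if b = 0 then w.getD a 0 else 0

/-- The size of an input: its words are counted with their bit lengths (and a separator). -/
def bitSize (w : List ℕ) : ℕ := (w.map fun x => 1 + Nat.size x).sum

/-- A search problem is given by an encoding of its instances as lists of words and by a predicate
saying which outputs (contents of bank `1` after halting) are correct for which instance. It is
solvable in polynomial time if one program halts on every instance with a correct output, at a
cost that is bounded by one polynomial in the bit size of the input. -/
def SolvableInPolyTime {ι : Type} (encode : ι → List ℕ) (correct : ι → (ℕ → ℕ) → Prop) : Prop :=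
  ∃ (p : Prog) (T : Polynomial ℕ), ∀ x : ι, ∃ (M : Mem) (t : ℕ),
    Run p (initMem (encode x)) M t ∧ t ≤ T.eval (bitSize (encode x)) ∧ correct x (M 1)

end RAM

/-! ### Auctions with `n` advertisers and `k` slots -/

namespace SponsoredSearch

/-- An allocation of slots to advertisers: every slot is given to at most one advertiser and every
advertiser gets at most one slot; slots may stay empty. `A i` is the placement of advertiser `i`
(`none`: no slot), and `A.symm j` is the advertiser in slot `j` (`none`: the slot is empty). -/
abbrev Allocation (n k : ℕ) : Type := Fin n ≃. Fin k

/-- The behaviour of the user: which advertisers receive a click, and which a purchase. -/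
abbrev Response (n : ℕ) : Type := (Fin n → Bool) × (Fin n → Bool)

/-- An outcome: the allocation, together with the clicks and purchases. -/
abbrev Outcome (n k : ℕ) : Type := Allocation n k × Response n

/-- For each allocation, the distribution of the outcome conditional on that allocation. -/
abbrev OutcomeModel (n k : ℕ) : Type := Allocation n k → PMF (Response n)

/-- The probability of the event `E`, given the allocation `A`. -/
noncomputable def prob {n k : ℕ} (μ : OutcomeModel n k) (A : Allocation n k)
    (E : Set (Outcome n k)) : ℝ :=
  ((μ A).toOuterMeasure {r | (A, r) ∈ E}).toReal

/-- The probability of `E` given any allocation depends only on the placement of the advertisers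
in `S`. -/
def DependsOnlyOn {n k : ℕ} (μ : OutcomeModel n k) (E : Set (Outcome n k))
    (S : Finset (Fin n)) : Prop :=
  ∀ A B : Allocation n k, (∀ i ∈ S, A i = B i) → prob μ A E = prob μ B E

/-- `E` is an `m`-dependent event. -/
def IsDependent {n k : ℕ} (μ : OutcomeModel n k) (m : ℕ) (E : Set (Outcome n k)) : Prop :=
  ∃ S : Finset (Fin n), S.card ≤ m ∧ DependsOnlyOn μ E S

/-- As soon as there is an advertiser, an event is `1`-dependent iff it can be labelled with one
advertiser on whose placement alone its probability depends. -/
theorem isDependent_one_iff {n k : ℕ} [NeZero n] (μ : OutcomeModel n k) (E : Set (Outcome n k)) :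
    IsDependent μ 1 E ↔ ∃ i : Fin n, DependsOnlyOn μ E {i} := by
  constructor
  · rintro ⟨S, hS, h⟩
    rcases Finset.card_le_one_iff_subset_singleton.1 hS with ⟨i, hi⟩
    exact ⟨i, fun A B hAB => h A B fun j hj => hAB j (hi hj)⟩
  · rintro ⟨i, h⟩
    exact ⟨{i}, by simp, h⟩

/-- One row "pay `amount` for `event`" of a Bids table, represented together with the label of the
advertiser on whose placement the event depends, and with the stored probabilities of the event for
each placement of that advertiser (`none`: no slot). -/
structure Bid (n k : ℕ) where
  amount : ℚ≥0
  event : Set (Outcome n k)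
  label : Fin n
  table : Option (Fin k) → ℚ≥0

/-- The allocation in which advertiser `i` has placement `s` and everybody else gets no slot. -/
def onlyPlace {n k : ℕ} (i : Fin n) : Option (Fin k) → Allocation n k
  | none => ⊥
  | some j => PEquiv.single i j

/-- The row is on a `1`-dependent event that depends on the labelled advertiser only, and the stored
numbers are the probabilities of the event for each placement of that advertiser. -/
structure Bid.IsValid {n k : ℕ} (μ : OutcomeModel n k) (b : Bid n k) : Prop where
  dependsOnlyOn : DependsOnlyOn μ b.event {b.label}
  table_eq : ∀ s : Option (Fin k), (b.table s : ℝ) = prob μ (onlyPlace b.label s) b.event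

/-- A winner determination instance: the (stochastic) behaviour of the users, and for each of the
`n` advertisers an OR-bid (Bids table), all of whose rows are on `1`-dependent events. -/
structure Auction where
  n : ℕ
  k : ℕ
  model : OutcomeModel n k
  bids : Fin n → List (Bid n k)
  valid : ∀ i, ∀ b ∈ bids i, b.IsValid model

/-- What the advertisers together pay in an outcome if they pay what they bid: the sum of the
amounts over all rows whose event is true. -/
noncomputable def Auction.revenue (I : Auction) (ω : Outcome I.n I.k) : ℝ :=
  ∑ i, ((I.bids i).map fun b => b.event.indicator (fun _ => (b.amount : ℝ)) ω).sum

/-- The expected revenue given an allocation. -/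
noncomputable def Auction.expectedRevenue (I : Auction) (A : Allocation I.n I.k) : ℝ :=
  ∑ r : Response I.n, (I.model A r).toReal * I.revenue (A, r)

/-- A rational number as numerator and denominator, in lowest terms. -/
def ratWords (q : ℚ≥0) : List ℕ := [q.num, q.den]

/-- A row as a list of words: the amount, the label, and the stored probabilities (for no slot
first, then for the slots in order). The event itself is not given to the algorithm. -/
def Bid.words {n k : ℕ} (b : Bid n k) : List ℕ :=
  ratWords b.amount ++ [b.label.val] ++ ratWords (b.table none) ++
    (List.finRange k).flatMap fun j => ratWords (b.table (some j))

/-- The input: the numbers of advertisers and slots, the list of the slots, and the Bids tables of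
the advertisers, each preceded by its number of rows. -/
def Auction.words (I : Auction) : List ℕ :=
  [I.n, I.k] ++ List.range I.k ++
    (List.finRange I.n).flatMap fun i => (I.bids i).length :: (I.bids i).flatMap Bid.words

/-- The output is a revenue-maximizing allocation: word `j` is `0` if slot `j` stays empty, and
`i + 1` if slot `j` is given to advertiser `i`. -/
def Auction.IsSolution (I : Auction) (out : ℕ → ℕ) : Prop :=
  ∃ A : Allocation I.n I.k,
    (∀ j : Fin I.k, out j = match A.symm j with
      | none => 0
      | some i => i.val + 1) ∧
    ∀ B : Allocation I.n I.k, I.expectedRevenue B ≤ I.expectedRevenue A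

end SponsoredSearch

/-! Winner determination is a maximum weight bipartite matching problem, which the Hungarian method
solves with polynomially many arithmetic operations.

*Reduction.* By `1`-dependence, the expected revenue of an allocation is the sum over all rows of
the amount times the stored probability at the placement of the labelled advertiser
(`Auction.expectedRevenue_eq`, `Bid.IsValid.prob_eq`). Collecting the rows by label, it is a sum of
one weight per advertiser, depending on the placement of this advertiser only. Multiplied by the
product of all denominators the weights are natural numbers (`Auction.mul_expectedRevenue`). As
having no slot may be worth more than having a slot, each advertiser also gets a dummy column with
the weight of "no slot"; then all advertisers can be assigned, to `n + k` columns.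

*Matching.* The rows are inserted one after the other. Nonnegative integral dual prices with
`w i j ≤ u i + p j`, tight on the assigned pairs and zero on free columns, certify optimality
(`IsAssigned.optimal`). For a new row, a tree of tight alternating paths is grown by one column at a
time, each time after a dual change by the minimal slack (`IsTree.grow`), until it contains a free
column; then the assignment is switched along the tree path (`IsHole.next`, `IsHole.isAssigned`).
All prices stay natural numbers, so that the machine's arithmetic is exact.

*Cost.* Correctness and cost are separated. In a *tame* program one factor of each multiplication is
an input word, so each assignment lengthens the words in memory by at most a constant multiple of
the input size. Hence if no loop is iterated more often than the size of the input, then the number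
of steps, the length of the words and the logarithmic cost are all polynomial, whatever the program
computes (`Exec.exists_run`). So it only remains to prove correctness together with bounds on the
numbers of iterations; this is done with weakest preconditions (`Wp`). -/

/-! ### Programs, expressions and memory -/

namespace RAM

instance : Add Expr := ⟨.add⟩
instance : Sub Expr := ⟨.sub⟩
instance : Mul Expr := ⟨.mul⟩
instance : Div Expr := ⟨.div⟩
instance (c : ℕ) : OfNat Expr c := ⟨.lit c⟩

/-- The scalar variable stored at address `0` of a bank of its own. -/
abbrev Expr.reg (b : ℕ) : Expr := .get b 0

section val
variable (M : Mem) (x y : Expr)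
@[simp] theorem Expr.val_add : (x + y).val M = x.val M + y.val M := rfl
@[simp] theorem Expr.val_sub : (x - y).val M = x.val M - y.val M := rfl
@[simp] theorem Expr.val_mul : (x * y).val M = x.val M * y.val M := rfl
@[simp] theorem Expr.val_div : (x / y).val M = x.val M / y.val M := rfl
@[simp] theorem Expr.val_ofNat (c : ℕ) : (ofNat(c) : Expr).val M = c := rfl
@[simp] theorem Expr.val_get (b : ℕ) : (Expr.get b x).val M = M b (x.val M) := rfl
end val

@[simp] theorem Mem.write_same (M : Mem) (b a v : ℕ) :
    M.write b a v b = Function.update (M b) a v := by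
  simp [Mem.write]

@[simp] theorem Mem.write_of_ne (M : Mem) {b b' : ℕ} (a v : ℕ) (h : b' ≠ b) :
    M.write b a v b' = M b' := by
  simp [Mem.write, h]

/-! ### Tame programs and the generic cost bound -/

/-- An expression is tame if one factor of each of its products is an input word. -/
def Expr.tame : Expr → Bool
  | lit _ => true
  | get _ a => a.tame
  | add x y => x.tame && y.tame
  | sub x y => x.tame && y.tame
  | mul x (get 0 a) => x.tame && a.tame
  | mul _ _ => false
  | div x y => x.tame && y.tame

/-- A syntactic measure of an expression, which bounds both the number of its nodes and the growth
in bit length that its evaluation can cause. -/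
def Expr.weight : Expr → ℕ
  | lit c => c.size + 1
  | get _ a => a.weight + 1
  | add x y => x.weight + y.weight + 1
  | sub x y => x.weight + y.weight + 1
  | mul x y => x.weight + y.weight + 1
  | div x y => x.weight + y.weight + 1

/-- A program is tame if its expressions are, and it never writes to the input bank. -/
def Prog.tame : Prog → Bool
  | skip => true
  | set b a e => b != 0 && a.tame && e.tame
  | seq p q => p.tame && q.tame
  | ite e p q => e.tame && p.tame && q.tame
  | loop e p => e.tame && p.tame

theorem Expr.val_lt {M : Mem} {B L : ℕ} (hL : 1 ≤ L) (hM : ∀ b a, M b a < 2 ^ B)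
    (h0 : ∀ a, M 0 a < 2 ^ L) (e : Expr) (he : e.tame) :
    e.val M < 2 ^ (B + L * e.weight) := by
  have mono : ∀ {v c d : ℕ}, v < 2 ^ (B + L * c) → c ≤ d → v < 2 ^ (B + L * d) :=
    fun h hcd => h.trans_le (Nat.pow_le_pow_right (by norm_num) (by gcongr))
  induction e with
  | lit c =>
    refine (Nat.lt_size_self c).trans_le (Nat.pow_le_pow_right (by norm_num) ?_)
    simp only [weight]
    nlinarith
  | get b a _ => exact (hM _ _).trans_le (Nat.pow_le_pow_right (by norm_num) (by omega))
  | add x y ihx ihy =>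
    simp only [tame, Bool.and_eq_true] at he
    have h1 := mono (ihx he.1) (Nat.le_add_right x.weight y.weight)
    have h2 := mono (ihy he.2) (Nat.le_add_left y.weight x.weight)
    have h3 : 2 ^ (B + L * (x.weight + y.weight) + 1) ≤
        2 ^ (B + L * (x.weight + y.weight + 1)) :=
      Nat.pow_le_pow_right (by norm_num) (by rw [Nat.mul_add L _ 1]; omega)
    rw [pow_succ] at h3
    simp only [val, weight]
    omega
  | sub x y ihx ihy =>
    simp only [tame, Bool.and_eq_true] at he
    exact (Nat.sub_le _ _).trans_lt (mono (ihx he.1) (by simp only [weight]; omega))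
  | mul x y ihx ihy =>
    match y, he with
    | get 0 a, he =>
      simp only [tame, Bool.and_eq_true] at he
      calc x.val M * M 0 (a.val M) < 2 ^ (B + L * x.weight) * 2 ^ L :=
            Nat.mul_lt_mul_of_lt_of_le (ihx he.1) (h0 _).le (by positivity)
        _ = 2 ^ (B + L * (x.weight + 1)) := by rw [← pow_add]; congr 1; ring
        _ ≤ _ := Nat.pow_le_pow_right (by norm_num) (by simp only [weight]; gcongr; omega)
  | div x y ihx ihy =>
    simp only [tame, Bool.and_eq_true] at he
    exact (Nat.div_le_self _ _).trans_lt (mono (ihx he.1) (by simp only [weight]; omega))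

theorem Expr.tame_of_mul {x y : Expr} (h : (Expr.mul x y).tame) : x.tame ∧ y.tame := by
  match y, h with
  | get 0 a, h => simpa [tame] using h

theorem Expr.cost_le {M : Mem} {B L : ℕ} (hL : 1 ≤ L) (hM : ∀ b a, M b a < 2 ^ B)
    (h0 : ∀ a, M 0 a < 2 ^ L) (W : ℕ) (e : Expr) (he : e.tame) (hW : e.weight ≤ W) :
    e.cost M ≤ e.weight * (1 + (B + L * W)) := by
  have hv : (e.val M).size ≤ B + L * W :=
    Nat.size_le.2 ((e.val_lt hL hM h0 he).trans_le
      (Nat.pow_le_pow_right (by norm_num) (by gcongr)))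
  induction e with
  | lit c => simp only [cost, weight, val] at *; nlinarith
  | get b a ih =>
    have := ih he (by simp only [weight] at hW; omega) (Nat.size_le.2
      ((a.val_lt hL hM h0 he).trans_le
      (Nat.pow_le_pow_right (by norm_num) (by gcongr; simp only [weight] at hW; omega))))
    simp only [cost, weight, val] at *; linarith
  | add x y ihx ihy | sub x y ihx ihy | div x y ihx ihy =>
    simp only [tame, Bool.and_eq_true] at he
    have hx := ihx he.1 (by simp only [weight] at hW; omega) (Nat.size_le.2
      ((x.val_lt hL hM h0 he.1).trans_le
      (Nat.pow_le_pow_right (by norm_num) (by gcongr; simp only [weight] at hW; omega))))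
    have hy := ihy he.2 (by simp only [weight] at hW; omega) (Nat.size_le.2
      ((y.val_lt hL hM h0 he.2).trans_le
      (Nat.pow_le_pow_right (by norm_num) (by gcongr; simp only [weight] at hW; omega))))
    simp only [cost, weight, val] at *; linarith
  | mul x y ihx ihy =>
    have he := tame_of_mul he
    have hx := ihx he.1 (by simp only [weight] at hW; omega) (Nat.size_le.2
      ((x.val_lt hL hM h0 he.1).trans_le
      (Nat.pow_le_pow_right (by norm_num) (by gcongr; simp only [weight] at hW; omega))))
    have hy := ihy he.2 (by simp only [weight] at hW; omega) (Nat.size_le.2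
      ((y.val_lt hL hM h0 he.2).trans_le
      (Nat.pow_le_pow_right (by norm_num) (by gcongr; simp only [weight] at hW; omega))))
    simp only [cost, weight, val] at *; linarith

/-- `Exec s p M M'`: the program `p` leads from memory `M` to memory `M'`, and none of its loops is
iterated more than `s` times in a row. -/
def Exec (s : ℕ) : Prog → Mem → Mem → Prop
  | .skip, M, M' => M' = M
  | .set b a e, M, M' => M' = M.write b (a.val M) (e.val M)
  | .seq p q, M, M' => ∃ M₁, Exec s p M M₁ ∧ Exec s q M₁ M'
  | .ite e p q, M, M' => (e.val M ≠ 0 ∧ Exec s p M M') ∨ (e.val M = 0 ∧ Exec s q M M')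
  | .loop e p, M, M' => ∃ c ≤ s, ∃ f : ℕ → Mem, f 0 = M ∧ f c = M' ∧ e.val M' = 0 ∧
      ∀ i < c, e.val (f i) ≠ 0 ∧ Exec s p (f i) (f (i + 1))

/-- A loop that is iterated `c` times, with a common bound on the costs of the iterations. -/
theorem run_loop {e : Expr} {p : Prog} {c D : ℕ} {f : ℕ → Mem} (h0 : e.val (f c) = 0)
    (hc : ∀ i ≤ c, e.cost (f i) ≤ D)
    (hs : ∀ i < c, e.val (f i) ≠ 0 ∧ ∃ t ≤ D, Run p (f i) (f (i + 1)) t) :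
    ∃ t ≤ (c + 1) * (2 * D + 1), Run (.loop e p) (f 0) (f c) t := by
  induction c generalizing f with
  | zero => exact ⟨e.cost (f 0) + 1, by have := hc 0 le_rfl; omega, by constructor; exact h0⟩
  | succ c ih =>
    obtain ⟨t, ht, hr⟩ := @ih (fun i => f (i + 1)) h0 (fun i hi => hc _ (by omega))
      (fun i hi => hs _ (by omega))
    obtain ⟨hne, t', ht', hr'⟩ := hs 0 (by omega)
    refine ⟨_, ?_, .loop_step hne hr' hr⟩
    have := hc 0 (by omega)
    nlinarith

/-- Executions of a tame program, with at most `s` iterations per loop and input words of at most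
`s` bits, have polynomial cost. The bit lengths in the memory grow by at most `G`, whatever they
are in the beginning; this makes the bound stable under iteration. -/
theorem Exec.exists_run (p : Prog) (hp : p.tame) : ∃ G : Polynomial ℕ, ∀ B : Polynomial ℕ,
    ∃ C : Polynomial ℕ, ∀ (s : ℕ) (M M' : Mem), 1 ≤ s → Exec s p M M' →
      (∀ b a, M b a < 2 ^ B.eval s) → (∀ a, M 0 a < 2 ^ s) →
      (∃ t ≤ C.eval s, Run p M M' t) ∧ (∀ b a, M' b a < 2 ^ (B.eval s + G.eval s)) ∧
        M' 0 = M 0 := by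
  have mono : ∀ {v c d : ℕ}, v < 2 ^ c → c ≤ d → v < 2 ^ d :=
    fun h hcd => h.trans_le (Nat.pow_le_pow_right (by norm_num) hcd)
  induction p with
  | skip =>
    refine ⟨0, fun B => ⟨1, ?_⟩⟩
    rintro s M M' - rfl hB -
    exact ⟨⟨1, by simp, .skip _⟩, by simpa using hB, rfl⟩
  | set b a e =>
    simp only [Prog.tame, Bool.and_eq_true, bne_iff_ne] at hp
    obtain ⟨⟨hb, ha⟩, he⟩ := hp
    refine ⟨.X * .C e.weight, fun B => ⟨.C a.weight * (1 + (B + .X * .C a.weight)) +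
      .C e.weight * (1 + (B + .X * .C e.weight)) + 1, ?_⟩⟩
    rintro s M M' hs rfl hB h0
    refine ⟨⟨_, ?_, .set _ _ _ _⟩, fun b' a' => ?_, Mem.write_of_ne _ _ _ (Ne.symm hb)⟩
    · have h1 := a.cost_le hs hB h0 _ ha le_rfl
      have h2 := e.cost_le hs hB h0 _ he le_rfl
      simp only [Polynomial.eval_add, Polynomial.eval_mul, Polynomial.eval_C, Polynomial.eval_X,
        Polynomial.eval_one]
      omega
    · have h1 := e.val_lt hs hB h0 he
      have h2 := mono (hB b' a') (Nat.le_add_right _ (s * e.weight))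
      simp only [Polynomial.eval_mul, Polynomial.eval_C, Polynomial.eval_X]
      rcases eq_or_ne b' b with rfl | hb'
      · rw [Mem.write_same, Function.update_apply]
        split_ifs
        · exact h1
        · exact h2
      · rwa [Mem.write_of_ne _ _ _ hb']
  | seq p q ihp ihq =>
    simp only [Prog.tame, Bool.and_eq_true] at hp
    obtain ⟨G, hG⟩ := ihp hp.1
    obtain ⟨G', hG'⟩ := ihq hp.2
    refine ⟨G + G', fun B => ?_⟩
    obtain ⟨C, hC⟩ := hG B
    obtain ⟨C', hC'⟩ := hG' (B + G)
    refine ⟨C + C' + 1, ?_⟩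
    rintro s M M' hs ⟨M₁, e1, e2⟩ hB h0
    obtain ⟨⟨t, ht, hr⟩, hb, hz⟩ := hC s M M₁ hs e1 hB h0
    obtain ⟨⟨t', ht', hr'⟩, hb', hz'⟩ := hC' s M₁ M' hs e2 (by simpa using hb) (by rwa [hz])
    refine ⟨⟨_, ?_, .seq hr hr'⟩, ?_, hz'.trans hz⟩
    · simp; omega
    · simpa [add_assoc] using hb'
  | ite e p q ihp ihq =>
    simp only [Prog.tame, Bool.and_eq_true] at hp
    obtain ⟨G, hG⟩ := ihp hp.1.2
    obtain ⟨G', hG'⟩ := ihq hp.2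
    refine ⟨G + G', fun B => ?_⟩
    obtain ⟨C, hC⟩ := hG B
    obtain ⟨C', hC'⟩ := hG' B
    refine ⟨.C e.weight * (1 + (B + .X * .C e.weight)) + C + C' + 1, ?_⟩
    rintro s M M' hs hE hB h0
    have h1 := e.cost_le hs hB h0 _ hp.1.1 le_rfl
    simp only [Polynomial.eval_add, Polynomial.eval_mul, Polynomial.eval_C, Polynomial.eval_X,
        Polynomial.eval_one]
    rcases hE with ⟨hne, e1⟩ | ⟨heq, e1⟩
    · obtain ⟨⟨t, ht, hr⟩, hb, hz⟩ := hC s M M' hs e1 hB h0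
      exact ⟨⟨_, by omega, .ite_true hne hr⟩, fun b a => mono (hb b a) (by omega), hz⟩
    · obtain ⟨⟨t, ht, hr⟩, hb, hz⟩ := hC' s M M' hs e1 hB h0
      exact ⟨⟨_, by omega, .ite_false heq hr⟩, fun b a => mono (hb b a) (by omega), hz⟩
  | loop e p ih =>
    simp only [Prog.tame, Bool.and_eq_true] at hp
    obtain ⟨G, hG⟩ := ih hp.2
    refine ⟨.X * G, fun B => ?_⟩
    obtain ⟨C, hC⟩ := hG (B + .X * G)
    refine ⟨(.X + 1) * (2 * (.C e.weight * (1 + (B + .X * G + .X * .C e.weight)) + C) + 1), ?_⟩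
    rintro s M M' hs ⟨c, hcs, f, rfl, rfl, hz, hf⟩ hB h0
    -- the exact growth `i * G` after `i` iterations needs the bound for all `B` at once
    have key : ∀ i ≤ c, (∀ b a, f i b a < 2 ^ (B.eval s + i * G.eval s)) ∧ f i 0 = f 0 0 := by
      intro i hi
      induction i with
      | zero => simpa using hB
      | succ i ih =>
        obtain ⟨h1, h2⟩ := ih (by omega)
        obtain ⟨C', hC'⟩ := hG (B + .C i * G)
        obtain ⟨-, hb, hz⟩ := hC' s _ _ hs (hf i (by omega)).2 (by simpa using h1) (by rwa [h2])
        refine ⟨fun b a => ?_, hz.trans h2⟩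
        have := hb b a
        simp only [Polynomial.eval_add, Polynomial.eval_mul, Polynomial.eval_C] at this
        rwa [add_mul, one_mul, ← add_assoc]
    have key' : ∀ i ≤ c, ∀ b a, f i b a < 2 ^ (B + .X * G).eval s := fun i hi b a =>
      mono ((key i hi).1 b a) (by simp; gcongr; omega)
    have h0' : ∀ i ≤ c, ∀ a, f i 0 a < 2 ^ s := fun i hi => by rwa [(key i hi).2]
    obtain ⟨t, ht, hr⟩ := run_loop (p := p)
      (D := (.C e.weight * (1 + (B + .X * G + .X * .C e.weight)) + C : Polynomial ℕ).eval s) hz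
      (fun i hi => by
        have := e.cost_le hs (key' i hi) (h0' i hi) _ hp.1 le_rfl
        simp at this ⊢
        omega)
      (fun i hi => by
        obtain ⟨⟨t, ht, hr⟩, -⟩ := hC s _ _ hs (hf i hi).2 (key' i hi.le) (h0' i hi.le)
        refine ⟨(hf i hi).1, t, ?_, hr⟩
        rw [Polynomial.eval_add]
        omega)
    refine ⟨⟨t, ht.trans ?_, hr⟩, fun b a => ?_, (key c le_rfl).2⟩
    · rw [Polynomial.eval_mul]
      refine Nat.mul_le_mul (by simpa using hcs) (by simp)
    · simpa using key' c le_rfl b a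

/-! ### Weakest preconditions -/

/-- The program `p`, started on `M`, halts with a memory that satisfies `Q`, and none of its loops
is iterated more than `s` times in a row. -/
def Wp (s : ℕ) (p : Prog) (M : Mem) (Q : Mem → Prop) : Prop := ∃ M', Exec s p M M' ∧ Q M'

section wp
variable {s : ℕ} {p q : Prog} {M : Mem} {Q R : Mem → Prop}

theorem Wp.mono (h : Wp s p M Q) (hQ : ∀ M, Q M → R M) : Wp s p M R :=
  let ⟨M', h1, h2⟩ := h; ⟨M', h1, hQ _ h2⟩

theorem wp_skip (h : Q M) : Wp s .skip M Q := ⟨M, rfl, h⟩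

theorem wp_set {b : ℕ} {a e : Expr} (h : Q (M.write b (a.val M) (e.val M))) :
    Wp s (.set b a e) M Q := ⟨_, rfl, h⟩

theorem wp_seq (h : Wp s p M fun M' => Wp s q M' Q) : Wp s (.seq p q) M Q :=
  let ⟨M', h1, M'', h2, h3⟩ := h; ⟨M'', ⟨M', h1, h2⟩, h3⟩

theorem wp_ite {e : Expr} (h1 : e.val M ≠ 0 → Wp s p M Q) (h2 : e.val M = 0 → Wp s q M Q) :
    Wp s (.ite e p q) M Q := by
  by_cases h : e.val M = 0
  · obtain ⟨M', h3, h4⟩ := h2 h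
    exact ⟨M', .inr ⟨h, h3⟩, h4⟩
  · obtain ⟨M', h3, h4⟩ := h1 h
    exact ⟨M', .inl ⟨h, h3⟩, h4⟩

/-- The rule for loops. The invariant `I` may depend on the number of completed iterations, and it
has to yield that there are at most `c` of them. -/
theorem wp_loop {e : Expr} (c : ℕ) (hc : c ≤ s) (I : ℕ → Mem → Prop) (h0 : I 0 M)
    (hI : ∀ i M, i ≤ c → I i M → e.val M ≠ 0 → i < c ∧ Wp s p M (I (i + 1)))
    (hQ : ∀ i M, i ≤ c → I i M → e.val M = 0 → Q M) : Wp s (.loop e p) M Q := by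
  suffices h : ∀ d i M, i + d = c → I i M → ∃ c' ≤ d, ∃ f : ℕ → Mem, f 0 = M ∧
      e.val (f c') = 0 ∧ Q (f c') ∧ ∀ i < c', e.val (f i) ≠ 0 ∧ Exec s p (f i) (f (i + 1)) by
    obtain ⟨c', hc', f, h1, h2, h3, h4⟩ := h c 0 M (by omega) h0
    exact ⟨f c', ⟨c', by omega, f, h1, rfl, h2, h4⟩, h3⟩
  intro d
  induction d with
  | zero =>
    intro i M hi hM
    have he : e.val M = 0 := by
      by_contra he
      have := (hI i M (by omega) hM he).1
      omega
    exact ⟨0, le_rfl, fun _ => M, rfl, he, hQ i M (by omega) hM he, by simp⟩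
  | succ d ih =>
    intro i M hi hM
    by_cases he : e.val M = 0
    · exact ⟨0, by omega, fun _ => M, rfl, he, hQ i M (by omega) hM he, by simp⟩
    · obtain ⟨-, M', h1, h2⟩ := hI i M (by omega) hM he
      obtain ⟨c', hc', f, h3, h4, h5, h6⟩ := ih (i + 1) M' (by omega) h2
      refine ⟨c' + 1, by omega, fun j => j.casesOn M f, rfl, h4, h5, ?_⟩
      rintro (_ | j) hj
      · exact ⟨he, by simpa [h3] using h1⟩
      · exact h6 j (by omega)

/-- `for v < bound do body`. The bound is evaluated again before each iteration. -/
def Prog.for (v : ℕ) (bound : Expr) (body : Prog) : Prog :=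
  .seq (.set v 0 0) (.loop (bound - .reg v) (.seq body (.set v 0 (.reg v + 1))))

/-- The rule for `for` loops whose body changes neither the bound nor the counter. -/
theorem wp_for {v c : ℕ} {bound : Expr} (hc : c ≤ s) (I : ℕ → Mem → Prop)
    (h0 : I 0 (M.write v 0 0))
    (hb : ∀ i M, I i M → bound.val M = c)
    (hI : ∀ i M, i < c → I i M → M v 0 = i →
      Wp s p M fun M' => M' v 0 = i ∧ I (i + 1) (M'.write v 0 (i + 1)))
    (hQ : ∀ M, I c M → Q M) : Wp s (.for v bound p) M Q := by
  refine wp_seq (wp_set (wp_loop c hc (fun i M => I i M ∧ M v 0 = i ∧ i ≤ c) ?_ ?_ ?_))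
  · simpa using h0
  · rintro i M - ⟨h1, h2, h3⟩ he
    have hi : i < c := by simp [hb i M h1, h2] at he; omega
    refine ⟨hi, wp_seq ((hI i M hi h1 h2).mono ?_)⟩
    rintro M' ⟨h4, h5⟩
    refine wp_set ?_
    simp [h4, h5]
    omega
  · rintro i M - ⟨h1, h2, h3⟩ he
    have hi : i = c := by simp [hb i M h1, h2] at he; omega
    exact hQ M (hi ▸ h1)

end wp

end RAM

/-! ### The Hungarian method -/

namespace Hungarian

/-- An optimal assignment of the rows `i < r` to the columns `j < m`, certified by dual prices.
Row `i` has column `f i - 1` and column `j` has row `g j - 1`, where the value `0` means that the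
row or column is unassigned. The prices `u`, `p` cover all weights, with equality on the assigned
pairs, and unassigned columns have price `0`. -/
structure IsAssigned (m r : ℕ) (w : ℕ → ℕ → ℕ) (u p f g : ℕ → ℕ) : Prop where
  row : ∀ i < r, ∃ j < m, f i = j + 1 ∧ g j = i + 1 ∧ w i j = u i + p j
  row_zero : ∀ i, r ≤ i → f i = 0
  col : ∀ j < m, ∀ i, g j = i + 1 → i < r ∧ f i = j + 1
  free : ∀ j < m, g j = 0 → p j = 0
  feas : ∀ i < r, ∀ j < m, w i j ≤ u i + p j

variable {m r c : ℕ} {w : ℕ → ℕ → ℕ} {u p f g S T prd : ℕ → ℕ}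

/-- Weak duality, with equality for the certified assignment. -/
theorem IsAssigned.optimal (h : IsAssigned m r w u p f g) (σ : ℕ → ℕ) (hσ : ∀ i < r, σ i < m)
    (hinj : ∀ i < r, ∀ j < r, σ i = σ j → i = j) :
    ∑ i ∈ Finset.range r, w i (σ i) ≤ ∑ i ∈ Finset.range r, w i (f i - 1) := by
  have hf : ∀ i < r, f i - 1 < m ∧ f i ≠ 0 ∧ w i (f i - 1) = u i + p (f i - 1) := by
    intro i hi
    obtain ⟨j, hj, h1, -, h2⟩ := h.row i hi
    simp [h1, hj, h2]
  have hfinj : ∀ i < r, ∀ j < r, f i - 1 = f j - 1 → i = j := by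
    intro i hi j hj hij
    obtain ⟨a, ha, h1, h2, -⟩ := h.row i hi
    obtain ⟨b, hb, h3, h4, -⟩ := h.row j hj
    grind
  calc ∑ i ∈ Finset.range r, w i (σ i)
      ≤ ∑ i ∈ Finset.range r, (u i + p (σ i)) := Finset.sum_le_sum fun i hi => by
        rw [Finset.mem_range] at hi
        exact h.feas i hi _ (hσ i hi)
    _ = ∑ i ∈ Finset.range r, u i + ∑ j ∈ (Finset.range r).image σ, p j := by
        rw [Finset.sum_add_distrib, Finset.sum_image]
        intro i hi j hj
        simpa using hinj i (by simpa using hi) j (by simpa using hj)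
    _ ≤ ∑ i ∈ Finset.range r, u i + ∑ j ∈ Finset.range m, p j := by
        gcongr
        intro j hj
        obtain ⟨i, hi, rfl⟩ := Finset.mem_image.1 hj
        simpa using hσ i (by simpa using hi)
    _ = ∑ i ∈ Finset.range r, u i + ∑ j ∈ (Finset.range r).image (fun i => f i - 1), p j := by
        congr 1
        refine (Finset.sum_subset ?_ ?_).symm
        · intro j hj
          obtain ⟨i, hi, rfl⟩ := Finset.mem_image.1 hj
          simpa using (hf i (by simpa using hi)).1
        · intro j hj hj'
          rw [Finset.mem_range] at hj
          refine h.free j hj ?_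
          by_contra h0
          obtain ⟨h1, h2⟩ := h.col j hj (g j - 1) (by omega)
          exact hj' (Finset.mem_image.2 ⟨g j - 1, by simpa using h1, by omega⟩)
    _ = ∑ i ∈ Finset.range r, (u i + p (f i - 1)) := by
        rw [Finset.sum_add_distrib, Finset.sum_image]
        intro i hi j hj
        simpa using hfinj i (by simpa using hi) j (by simpa using hj)
    _ = _ := Finset.sum_congr rfl fun i hi => ((hf i (by simpa using hi)).2.2).symm

/-- The rows `i < r` cannot occupy more than `r` columns. -/
theorem IsAssigned.exists_free (h : IsAssigned m r w u p f g) (hr : r < m) :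
    ∃ j < m, g j = 0 := by
  by_contra! h0
  have hm : ∀ j ∈ Finset.range m, g j - 1 ∈ Finset.range r := by
    intro j hj
    rw [Finset.mem_range] at *
    exact (h.col j hj (g j - 1) (by have := h0 j hj; omega)).1
  obtain ⟨i, hi, j, hj, hne, heq⟩ :=
    Finset.exists_ne_map_eq_of_card_lt_of_maps_to (by simpa using hr) hm
  rw [Finset.mem_range] at hi hj
  have h1 := (h.col i hi (g i - 1) (by have := h0 i hi; omega)).2
  have h2 := (h.col j hj (g j - 1) (by have := h0 j hj; omega)).2
  rw [heq] at h1
  omega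

/-- An alternating tree of tight edges that is rooted at the unassigned row `r`, with rows
`{i | S i ≠ 0}` and columns `{j | T j ≠ 0}`. Here `T j` is the time at which column `j` joined the
tree, as a neighbour of row `prd j`; so the column of row `prd j`, if any, joined before. The number
of columns in the tree is `c`. -/
structure IsTree (m r : ℕ) (w : ℕ → ℕ → ℕ) (u p f g S T prd : ℕ → ℕ) (c : ℕ) : Prop where
  assigned : IsAssigned m r w u p f g
  feas_root : ∀ j < m, w r j ≤ u r + p j
  le_root : ∀ i, S i ≠ 0 → i ≤ r
  root_mem : S r ≠ 0
  mate : ∀ i < r, ∀ j < m, f i = j + 1 → (S i ≠ 0 ↔ T j ≠ 0)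
  time_le : ∀ j < m, T j ≤ c
  prd_mem : ∀ j < m, T j ≠ 0 → S (prd j) ≠ 0
  tight : ∀ j < m, T j ≠ 0 → w (prd j) j = u (prd j) + p j
  lt_time : ∀ j < m, T j ≠ 0 → ∀ j' < m, f (prd j) = j' + 1 → T j' < T j
  card : ((Finset.range m).filter (T · ≠ 0)).card = c

/-- The tree that consists of the root only, with a price `U` that covers all its weights. -/
theorem IsAssigned.isTree (h : IsAssigned m r w u p f g) {U : ℕ} (hU : ∀ j < m, w r j ≤ U)
    (hT : ∀ j < m, T j = 0) :
    IsTree m r w (Function.update u r U) p f g (Function.update (fun _ => 0) r 1) T prd 0 where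
  assigned :=
    { row := fun i hi => by
        rw [Function.update_of_ne hi.ne]
        exact h.row i hi
      row_zero := h.row_zero
      col := h.col
      free := h.free
      feas := fun i hi => by
        rw [Function.update_of_ne hi.ne]
        exact h.feas i hi }
  feas_root j hj := by
    have := hU j hj
    simp
    omega
  le_root i hi := by
    by_contra h0
    rw [Function.update_of_ne (by omega)] at hi
    exact hi rfl
  root_mem := by simp
  mate i hi j hj _ := by simp [Function.update_of_ne hi.ne, hT j hj]
  time_le j hj := (hT j hj).le
  prd_mem j hj h0 := absurd (hT j hj) h0
  tight j hj h0 := absurd (hT j hj) h0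
  lt_time j hj h0 := absurd (hT j hj) h0
  card := by simpa [Finset.filter_eq_empty_iff] using hT

/-- The dual step followed by the growth of the tree. The amount `δ` is the minimal slack of an
edge that leaves the tree, attained by the edge from row `a` to column `b`; after the change of the
prices this edge is tight, and `b` joins the tree together with its row (if it has one). -/
theorem IsTree.grow (h : IsTree m r w u p f g S T prd c) (hr : r < m)
    (hT : ∀ j < m, T j ≠ 0 → g j ≠ 0) {a b δ : ℕ} (ha : S a ≠ 0) (hb : b < m) (hTb : T b = 0)
    (hδ : w a b + δ = u a + p b)
    (hmin : ∀ i j, S i ≠ 0 → j < m → T j = 0 → w i j + δ ≤ u i + p j) :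
    IsTree m r w (fun i => if S i ≠ 0 then u i - δ else u i)
      (fun j => if j < m ∧ T j ≠ 0 then p j + δ else p j) f g
      (if g b = 0 then S else Function.update S (g b - 1) 1)
      (Function.update T b (c + 1)) (Function.update prd b a) (c + 1) := by
  obtain ⟨j₀, hj₀, hg₀⟩ := h.assigned.exists_free hr
  have hT₀ : T j₀ = 0 := by
    by_contra h0
    exact hT j₀ hj₀ h0 hg₀
  -- a free column has price `0`, so the slack of its edge to row `i` is at most `u i`; hence the
  -- truncated subtraction in `u i - δ` is exact
  have hδu : ∀ i, S i ≠ 0 → δ ≤ u i := fun i hi => by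
    have := hmin i j₀ hi hj₀ hT₀
    have := h.assigned.free j₀ hj₀ hg₀
    omega
  have hfeas : ∀ i, i ≤ r → ∀ j < m, w i j ≤ u i + p j := fun i hi j hj => by
    rcases hi.eq_or_lt with rfl | hi
    · exact h.feas_root j hj
    · exact h.assigned.feas i hi j hj
  have hfeas' : ∀ i, i ≤ r → ∀ j < m, w i j ≤ (if S i ≠ 0 then u i - δ else u i) +
      (if j < m ∧ T j ≠ 0 then p j + δ else p j) := fun i hi j hj => by
    have h1 := hfeas i hi j hj
    have h2 := hmin i j
    have h3 := hδu i
    split_ifs <;> grind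
  refine
    { assigned :=
        { row := fun i hi => ?_
          row_zero := h.assigned.row_zero
          col := h.assigned.col
          free := fun j hj hg => ?_
          feas := fun i hi => hfeas' i hi.le }
      feas_root := hfeas' r le_rfl
      le_root := fun i hi => ?_
      root_mem := ?_
      mate := fun i hi j hj hf => ?_
      time_le := fun j hj => ?_
      prd_mem := fun j hj => ?_
      tight := fun j hj => ?_
      lt_time := fun j hj => ?_
      card := ?_ }
  · obtain ⟨j, hj, h1, h2, h3⟩ := h.assigned.row i hi
    have := h.mate i hi j hj h1
    have := hδu i
    exact ⟨j, hj, h1, h2, by grind⟩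
  · have := hT j hj
    have := h.assigned.free j hj hg
    grind
  · have := h.le_root i
    have := h.assigned.col b hb (g b - 1)
    grind
  · have := h.root_mem
    grind
  · have h1 := h.mate i hi j hj hf
    have h2 := h.assigned.col b hb (g b - 1)
    obtain ⟨j', -, h3, h4, -⟩ := h.assigned.row i hi
    grind
  · have := h.time_le j hj
    grind
  · have := h.prd_mem j hj
    grind
  · have := h.prd_mem j hj
    have := h.tight j hj
    have := hδu (prd j)
    have := hδu a
    grind
  · intro hj0 j' hj' hf
    have h1 := h.lt_time j hj
    have h2 := h.time_le j' hj'
    have h3 := h.mate (prd j)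
    have h4 := h.prd_mem j hj
    have h5 := h.le_root (prd j)
    have h6 := h.assigned.row_zero (prd j)
    have h7 := h.mate a
    have h8 := h.le_root a ha
    have h9 := h.assigned.row_zero a
    grind
  · have : (Finset.range m).filter (Function.update T b (c + 1) · ≠ 0) =
        insert b ((Finset.range m).filter (T · ≠ 0)) := by
      ext j
      simp only [Finset.mem_filter, Finset.mem_range, Finset.mem_insert, Function.update_apply]
      grind
    rw [this, Finset.card_insert_of_notMem (by simp [hTb]), h.card]

theorem IsTree.card_le (h : IsTree m r w u p f g S T prd c) : c ≤ m := by
  rw [← h.card]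
  exact (Finset.card_filter_le _ _).trans (by simp)

theorem IsTree.card_lt (h : IsTree m r w u p f g S T prd c) (hr : r < m)
    (hT : ∀ j < m, T j ≠ 0 → g j ≠ 0) : c < m := by
  obtain ⟨j₀, hj₀, hg₀⟩ := h.assigned.exists_free hr
  rw [← h.card]
  refine (Finset.card_lt_card (Finset.filter_ssubset.2 ⟨j₀, by simpa using hj₀, ?_⟩)).trans_eq
    (by simp)
  intro h0
  exact hT j₀ hj₀ h0 hg₀

/-- The situation while the assignment is switched along the tree path from a free column to the
root: the rows `i < r` are assigned, row `r` is not, and column `b` of the tree (the hole, whose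
entry of `g` is meaningless) is available for row `prd b`. -/
structure IsHole (m r : ℕ) (w : ℕ → ℕ → ℕ) (u p f g T prd : ℕ → ℕ) (b : ℕ) : Prop where
  lt : b < m
  mem : T b ≠ 0
  row : ∀ i < r, ∃ j < m, j ≠ b ∧ f i = j + 1 ∧ g j = i + 1 ∧ w i j = u i + p j
  row_zero : ∀ i, r ≤ i → f i = 0
  col : ∀ j < m, j ≠ b → ∀ i, g j = i + 1 → i < r ∧ f i = j + 1
  free : ∀ j < m, j ≠ b → g j = 0 → p j = 0
  feas : ∀ i ≤ r, ∀ j < m, w i j ≤ u i + p j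
  prd_le : ∀ j < m, T j ≠ 0 → T j ≤ T b → prd j ≤ r
  tight : ∀ j < m, T j ≠ 0 → T j ≤ T b → w (prd j) j = u (prd j) + p j
  lt_time : ∀ j < m, T j ≠ 0 → T j ≤ T b → ∀ j' < m, f (prd j) = j' + 1 → T j' ≠ 0 ∧ T j' < T j

/-- A free column of the tree is a hole from which the path to the root can be switched. -/
theorem IsTree.isHole (h : IsTree m r w u p f g S T prd c) {b : ℕ} (hb : b < m) (hT : T b ≠ 0)
    (hg : g b = 0) : IsHole m r w u p f g T prd b where
  lt := hb
  mem := hT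
  row i hi := by
    obtain ⟨j, hj, h1, h2, h3⟩ := h.assigned.row i hi
    exact ⟨j, hj, by grind, h1, h2, h3⟩
  row_zero := h.assigned.row_zero
  col j hj _ := h.assigned.col j hj
  free j hj _ := h.assigned.free j hj
  feas i hi j hj := by
    rcases hi.eq_or_lt with rfl | hi
    · exact h.feas_root j hj
    · exact h.assigned.feas i hi j hj
  prd_le j hj h0 _ := h.le_root _ (h.prd_mem j hj h0)
  tight j hj h0 _ := h.tight j hj h0
  lt_time j hj h0 _ j' hj' hf := by
    refine ⟨?_, h.lt_time j hj h0 j' hj' hf⟩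
    have h1 := h.prd_mem j hj h0
    have h2 := h.le_root _ h1
    have h3 := h.assigned.row_zero (prd j)
    have h4 := h.mate (prd j)
    grind

/-- If row `prd b` is unassigned, then it is the root, and the switch is complete. -/
theorem IsHole.isAssigned {b : ℕ} (h : IsHole m r w u p f g T prd b) (h0 : f (prd b) = 0) :
    IsAssigned m (r + 1) w u p (Function.update f (prd b) (b + 1))
      (Function.update g b (prd b + 1)) := by
  have hlt := h.lt
  have hle := h.prd_le b h.lt h.mem le_rfl
  have ht := h.tight b h.lt h.mem le_rfl
  have hr : prd b = r := by
    by_contra hne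
    obtain ⟨j, -, -, h1, -⟩ := h.row (prd b) (by omega)
    omega
  rw [hr] at hle ht h0 ⊢
  refine ⟨fun i hi => ?_, fun i hi => ?_, fun j hj i hg => ?_, fun j hj hg => ?_,
    fun i hi => h.feas i (by omega)⟩
  · rcases Nat.lt_succ_iff_lt_or_eq.1 hi with hi | rfl
    · obtain ⟨j, hj, h1⟩ := h.row i hi
      exact ⟨j, hj, by grind⟩
    · exact ⟨b, hlt, by simpa using ht⟩
  · have := h.row_zero i
    grind
  · have := fun hne => h.col j hj hne i
    simp only [Function.update_apply] at hg ⊢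
    grind
  · have := h.free j hj
    grind

/-- If row `prd b` has a column, then this column becomes the hole when the row moves to `b`. The
times `T` decrease, so this happens only finitely often; and later switches do not use row `prd b`
again, so that its new column does not disturb the rest of the path. -/
theorem IsHole.next {b : ℕ} (h : IsHole m r w u p f g T prd b) (h0 : f (prd b) ≠ 0) :
    T (f (prd b) - 1) < T b ∧ IsHole m r w u p (Function.update f (prd b) (b + 1))
      (Function.update g b (prd b + 1)) T prd (f (prd b) - 1) := by
  have hlt := h.lt
  have hle := h.prd_le b h.lt h.mem le_rfl
  have ht := h.tight b h.lt h.mem le_rfl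
  have hr : prd b < r := by
    by_contra hne
    exact h0 (h.row_zero _ (by omega))
  obtain ⟨j₁, hj₁, hne, hf, hg, ht₁⟩ := h.row _ hr
  obtain ⟨hT₁, hT₂⟩ := h.lt_time b hlt h.mem le_rfl j₁ hj₁ hf
  rw [hf, Nat.add_sub_cancel]
  refine ⟨hT₂, hj₁, hT₁, fun i hi => ?_, fun i hi => ?_, fun j hj hj' i hg => ?_,
    fun j hj hj' hg => ?_, h.feas, fun j hj hT hT' => ?_, fun j hj hT hT' => ?_,
    fun j hj hT hT' j' hj' => ?_⟩
  · by_cases hi' : i = prd b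
    · exact ⟨b, hlt, by grind⟩
    · obtain ⟨j, hj, h1⟩ := h.row i hi
      exact ⟨j, hj, by grind⟩
  · have := h.row_zero i hi
    grind
  · have := fun hne => h.col j hj hne i
    simp only [Function.update_apply] at hg ⊢
    grind
  · have := h.free j hj
    grind
  · exact h.prd_le j hj hT (by omega)
  · exact h.tight j hj hT (by omega)
  · have h1 := h.lt_time j hj hT (by omega)
    have h2 := h1 j₁ hj₁
    have h3 := h1 j' hj'
    grind

end Hungarian

/-! ### The Hungarian method as a program -/

/-! The banks of the algorithm. Banks `2` to `16` hold scalar variables (at address `0`): the current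
position in the input, the number of rows of the Bids tables, loop counters, the length of the
current table, the common denominator, the sum of all weights, a temporary value, and, for the
search, the root, the flag that a free column has been found, the dual change, the row and the
column of an edge, the pointer along the augmenting path, and the number of rounds. The others hold
arrays: the addresses of the rows of the Bids tables, the weights, and the functions `u`, `p`, `f`,
`g`, `S`, `T`, `prd` of `Hungarian.IsTree`. -/

notation "bankPos" => 2
notation "bankCnt" => 3
notation "bankI" => 4
notation "bankJ" => 5
notation "bankLen" => 6
notation "bankDen" => 7
notation "bankTot" => 8
notation "bankTmp" => 9
notation "bankRoot" => 10
notation "bankDone" => 11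
notation "bankDelta" => 12
notation "bankA" => 13
notation "bankB" => 14
notation "bankCur" => 15
notation "bankTime" => 16
notation "bankRow" => 20
notation "bankW" => 21
notation "bankU" => 22
notation "bankP" => 23
notation "bankF" => 24
notation "bankG" => 25
notation "bankS" => 26
notation "bankT" => 27
notation "bankPrd" => 28

namespace RAM

/-- The memories `M` and `M'` differ at most in the banks listed in `L`. -/
def Agree (L : List ℕ) (M M' : Mem) : Prop := ∀ b, b ∉ L → M b = M' b

theorem Agree.refl (L : List ℕ) (M : Mem) : Agree L M M := fun _ _ => rfl

theorem Agree.trans {L L' L'' : List ℕ} {M M' M'' : Mem} (h : Agree L M M') (h' : Agree L' M' M'')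
    (hL : L ⊆ L'' := by decide) (hL' : L' ⊆ L'' := by decide) : Agree L'' M M'' :=
  fun b hb => (h b fun h1 => hb (hL h1)).trans (h' b fun h1 => hb (hL' h1))

theorem Agree.write {L : List ℕ} {M M' : Mem} (h : Agree L M M') {b : ℕ} (a v : ℕ)
    (hb : b ∈ L := by decide) : Agree L (M.write b a v) M' := by
  intro b' hb'
  rw [Mem.write_of_ne _ _ _ (by rintro rfl; exact hb' hb), h b' hb']

open _root_.RAM.Expr _root_.RAM.Prog Hungarian

/-- The number of advertisers. -/
abbrev numRows : Expr := get 0 0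

/-- The number of columns of the assignment problem: one dummy column for each advertiser (columns
`0, …, n - 1`), and the slots (columns `n, …, n + k - 1`). -/
abbrev numCols : Expr := get 0 0 + get 0 1

/-- The weight of the pair of row `i` and column `j`. The weights of an advertiser are stored in the
order "no slot, slot `1`, …, slot `k`", so that truncated subtraction maps all dummy columns to the
entry for "no slot". -/
abbrev weightExpr (i j : Expr) : Expr := get bankW (i * get 0 1 + i + (j + 1 - get 0 0))

/-- The weights of the assignment problem that are stored in memory. -/
def storedWeight (M : Mem) (i j : ℕ) : ℕ := M bankW (i * M 0 1 + i + (j + 1 - M 0 0))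

/-- Find an edge of minimal slack that leaves the tree. The search starts with a bound that exceeds
the slack of the edge from the root to a free column, so that some edge is found. -/
def minSlack : Prog :=
  .seq (.set bankDelta 0 (get bankU (reg bankRoot) + 1)) <|
  .for bankI numRows <| .for bankJ numCols <|
    .ite (get bankS (reg bankI))
      (.ite (get bankT (reg bankJ)) .skip <|
        .seq (.set bankTmp 0 (get bankU (reg bankI) + get bankP (reg bankJ) -
          weightExpr (reg bankI) (reg bankJ))) <|
        .ite (reg bankDelta - reg bankTmp)
          (.seq (.set bankDelta 0 (reg bankTmp)) <|
            .seq (.set bankA 0 (reg bankI)) (.set bankB 0 (reg bankJ)))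
          .skip)
      .skip

section
variable {s n k : ℕ} {M : Mem}

theorem wp_minSlack (hn : M 0 0 = n) (hk : M 0 1 = k) (hs : n + k ≤ s)
    {r j₀ : ℕ} (hr : M bankRoot 0 = r) (hrn : r < n) (hS : M bankS r ≠ 0)
    (hj₀ : j₀ < n + k) (hT₀ : M bankT j₀ = 0)
    (hP₀ : M bankP j₀ = 0) :
    Wp s minSlack M fun M' => Agree [bankDelta, bankI, bankJ, bankTmp, bankA, bankB] M' M ∧
      M bankS (M' bankA 0) ≠ 0 ∧ M' bankB 0 < n + k ∧ M bankT (M' bankB 0) = 0 ∧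
      M' bankDelta 0 = M bankU (M' bankA 0) + M bankP (M' bankB 0) -
        storedWeight M (M' bankA 0) (M' bankB 0) ∧
      ∀ i < n, ∀ j < n + k, M bankS i ≠ 0 → M bankT j = 0 →
        M' bankDelta 0 ≤ M bankU i + M bankP j - storedWeight M i j := by
  refine wp_seq (wp_set ?_)
  let slack i j := M bankU i + M bankP j - storedWeight M i j
  -- `X i j`: the pair `(i, j)` has already been inspected
  let I (X : ℕ → ℕ → Prop) (M' : Mem) : Prop :=
    Agree [bankDelta, bankI, bankJ, bankTmp, bankA, bankB] M' M ∧
    (M' bankDelta 0 = M bankU r + 1 ∨ M bankS (M' bankA 0) ≠ 0 ∧ M' bankB 0 < n + k ∧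
      M bankT (M' bankB 0) = 0 ∧ M' bankDelta 0 = slack (M' bankA 0) (M' bankB 0)) ∧
    ∀ i j, X i j → M bankS i ≠ 0 → M bankT j = 0 → M' bankDelta 0 ≤ slack i j
  have hI : ∀ {X Y : ℕ → ℕ → Prop} {M'}, (∀ i j, Y i j → X i j) → I X M' → I Y M' :=
    fun hXY h => ⟨h.1, h.2.1, fun i j hij => h.2.2 i j (hXY i j hij)⟩
  refine wp_for (c := n) (by omega) (fun i => I (fun i' j' => i' < i ∧ j' < n + k)) ?_ ?_ ?_ ?_
  · exact ⟨((Agree.refl _ M).write _ _).write _ _, .inl (by simp [hr]), by simp⟩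
  · rintro i M' ⟨h1, -⟩
    simpa [h1 0 (by decide)] using hn
  · rintro i M₁ hi hI₁ hiv
    refine wp_for (c := n + k) hs (fun j M' => M' bankI 0 = i ∧
      I (fun i' j' => i' < i ∧ j' < n + k ∨ i' = i ∧ j' < j) M') ?_ ?_ ?_ ?_
    · refine ⟨by simpa using hiv, hI₁.1.write _ _, by simpa using hI₁.2.1, ?_⟩
      simpa using fun i j h1 h2 => hI₁.2.2 i j ⟨h1, h2⟩
    · rintro j M' ⟨-, h1, -⟩
      simp [h1 0 (by decide), hn, hk]
    · rintro j M₂ hj ⟨hiv₂, hI₂⟩ hjv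
      have e0 := hI₂.1 0 (by decide)
      have eU := hI₂.1 bankU (by decide)
      have eP := hI₂.1 bankP (by decide)
      have eS := hI₂.1 bankS (by decide)
      have eT := hI₂.1 bankT (by decide)
      have eW := hI₂.1 bankW (by decide)
      -- an uninteresting pair
      have skip : (M bankS i ≠ 0 → M bankT j = 0 → M₂ bankDelta 0 ≤ slack i j) →
          M₂ bankJ 0 = j ∧ (M₂.write bankJ 0 (j + 1)) bankI 0 = i ∧
            I (fun i' j' => i' < i ∧ j' < n + k ∨ i' = i ∧ j' < j + 1)
              (M₂.write bankJ 0 (j + 1)) := by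
        intro h
        refine ⟨hjv, by simpa using hiv₂, hI₂.1.write _ _, by simpa using hI₂.2.1, ?_⟩
        intro i' j' hij hS' hT'
        have := hI₂.2.2 i' j'
        rw [Mem.write_of_ne _ _ _ (by decide)]
        by_cases hij' : i' = i ∧ j' = j
        · obtain ⟨rfl, rfl⟩ := hij'
          exact h hS' hT'
        · exact this (by omega) hS' hT'
      refine wp_ite (fun hS' => wp_ite (fun hT' => wp_skip (skip ?_)) fun hT' => wp_seq (wp_set ?_))
        fun hS' => wp_skip (skip ?_)
      · intro _ h
        simp [hjv, eT, h] at hT'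
      · have hslack : (get bankU (reg bankI) + get bankP (reg bankJ) -
            weightExpr (reg bankI) (reg bankJ)).val M₂ = slack i j := by
          simp [hjv, hiv₂, eU, eP, eW, e0, slack, storedWeight]
        rw [hslack]
        refine wp_ite (fun hlt => wp_seq (wp_set (wp_seq (wp_set (wp_set ?_))))) fun hge => ?_
        · simp at hlt
          refine ⟨by simpa using hjv, by simpa using hiv₂, ?_, .inr ?_, ?_⟩
          · exact (((((hI₂.1.write _ _).write _ _).write _ _).write _ _).write _ _)
          · simp [hiv₂, hjv] at hS' hT' ⊢
            exact ⟨by rwa [← eS], hj, by rwa [← eT]⟩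
          · intro i' j' hij hS'' hT''
            have := hI₂.2.2 i' j'
            simp
            by_cases hij' : i' = i ∧ j' = j
            · rw [hij'.1, hij'.2]
            · have := this (by omega) hS'' hT''
              omega
        · simp at hge
          have h3 := skip fun _ _ => by omega
          refine wp_skip ⟨by simpa using hjv, by simpa using hiv₂,
            (hI₂.1.write _ _).write _ _, by simpa using h3.2.2.2.1, ?_⟩
          simpa using h3.2.2.2.2
      · intro h
        simp [hiv₂, eS, h] at hS'
    · rintro M₂ ⟨hiv₂, hI₂⟩
      refine ⟨hiv₂, hI₂.1.write _ _, by simpa using hI₂.2.1, ?_⟩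
      intro i' j' hij
      rw [Mem.write_of_ne _ _ _ (by decide)]
      exact hI₂.2.2 i' j' (by omega)
  · rintro M' ⟨h1, h2, h3⟩
    have h4 := h3 r j₀ ⟨hrn, hj₀⟩ hS hT₀
    simp only [slack, hP₀] at h4
    rcases h2 with h2 | h2
    · omega
    · exact ⟨h1, h2.1, h2.2.1, h2.2.2.1, h2.2.2.2, fun i hi j hj => h3 i j ⟨hi, hj⟩⟩

end
end RAM

namespace RAM
open _root_.RAM.Expr _root_.RAM.Prog Hungarian

/-- Apply the dual change `bankDelta` to the prices of the rows and columns in the tree. -/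
def updatePrices : Prog :=
  .seq (.for bankI numRows <| .ite (get bankS (reg bankI))
      (.set bankU (reg bankI) (get bankU (reg bankI) - reg bankDelta)) .skip) <|
  .for bankJ numCols <| .ite (get bankT (reg bankJ))
      (.set bankP (reg bankJ) (get bankP (reg bankJ) + reg bankDelta)) .skip

/-- One round of the search: the dual change, and the growth of the tree by the column of an edge
that has become tight. The search is over when this column is free. -/
def growTree : Prog :=
  .seq minSlack <| .seq updatePrices <|
  .seq (.set bankTime 0 (reg bankTime + 1)) <|
  .seq (.set bankT (reg bankB) (reg bankTime)) <|
  .seq (.set bankPrd (reg bankB) (reg bankA)) <|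
  .ite (get bankG (reg bankB)) (.set bankS (get bankG (reg bankB) - 1) 1) (.set bankDone 0 1)

/-- Grow the tree until it contains a free column. -/
def searchTree : Prog := .loop (1 - reg bankDone) growTree

/-- Switch the assignment along the tree path from column `bankB` to the root. -/
def augment : Prog :=
  .seq (.set bankCur 0 1) <| .loop (reg bankCur) <|
  .seq (.set bankA 0 (get bankPrd (reg bankB))) <|
  .seq (.set bankCur 0 (get bankF (reg bankA))) <|
  .seq (.set bankF (reg bankA) (reg bankB + 1)) <|
  .seq (.set bankG (reg bankB) (reg bankA + 1)) <|
  .set bankB 0 (reg bankCur - 1)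

/-- Start a tree that consists of the row `bankRoot` only. -/
def initTree : Prog :=
  .seq (.set bankU (reg bankRoot) (reg bankTot)) <|
  .seq (.for bankI numRows <| .set bankS (reg bankI) 0) <|
  .seq (.for bankJ numCols <| .set bankT (reg bankJ) 0) <|
  .seq (.set bankS (reg bankRoot) 1) <|
  .seq (.set bankTime 0 0) (.set bankDone 0 0)

/-- The Hungarian method: the rows are assigned one after the other. -/
def hungarian : Prog :=
  .for bankRoot numRows <| .seq initTree <| .seq searchTree augment

section
variable {s n k : ℕ} {M : Mem}

theorem wp_updatePrices (hn : M 0 0 = n) (hk : M 0 1 = k) (hs : n + k ≤ s)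
    (hS : ∀ i, M bankS i ≠ 0 → i < n) :
    Wp s updatePrices M fun M' => Agree [bankI, bankJ, bankU, bankP] M' M ∧
      M' bankU = (fun i => if M bankS i ≠ 0 then M bankU i - M bankDelta 0 else M bankU i) ∧
      M' bankP = fun j =>
        if j < n + k ∧ M bankT j ≠ 0 then M bankP j + M bankDelta 0 else M bankP j := by
  refine wp_seq (wp_for (c := n) (by omega) (fun i M' => Agree [bankI, bankU] M' M ∧
    M' bankU = fun i' => if i' < i ∧ M bankS i' ≠ 0 then M bankU i' - M bankDelta 0
      else M bankU i') ?_ ?_ ?_ ?_)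
  · exact ⟨(Agree.refl _ _).write _ _, by simp⟩
  · rintro i M' ⟨h1, -⟩
    simpa [h1 0 (by decide)] using hn
  · rintro i M' hi ⟨h1, h2⟩ hiv
    have eS := h1 bankS (by decide)
    have eD := h1 bankDelta (by decide)
    refine wp_ite (fun hS' => wp_set ?_) fun hS' => wp_skip ?_
    · simp [hiv, eS] at hS'
      refine ⟨by simpa using hiv, (h1.write _ _).write _ _, ?_⟩
      ext i'
      simp [hiv, h2, eD, Function.update_apply]
      grind
    · simp [hiv, eS] at hS'
      refine ⟨hiv, h1.write _ _, ?_⟩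
      ext i'
      simp [h2]
      grind
  rintro M₁ ⟨h1, h2⟩
  have e0 := h1 0 (by decide)
  refine wp_for (c := n + k) hs (fun j M' => Agree [bankJ, bankP] M' M₁ ∧
    M' bankP = fun j' => if j' < j ∧ M bankT j' ≠ 0 then M bankP j' + M bankDelta 0
      else M bankP j') ?_ ?_ ?_ ?_
  · exact ⟨(Agree.refl _ _).write _ _, by simp [h1 bankP (by decide)]⟩
  · rintro j M' ⟨h3, -⟩
    simp [h3 0 (by decide), e0, hn, hk]
  · rintro j M' hj ⟨h3, h4⟩ hjv
    have eT := (h3 bankT (by decide)).trans (h1 bankT (by decide))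
    have eD := (h3 bankDelta (by decide)).trans (h1 bankDelta (by decide))
    refine wp_ite (fun hT' => wp_set ?_) fun hT' => wp_skip ?_
    · simp [hjv, eT] at hT'
      refine ⟨by simpa using hjv, (h3.write _ _).write _ _, ?_⟩
      ext j'
      simp [hjv, h4, eD, Function.update_apply]
      grind
    · simp [hjv, eT] at hT'
      refine ⟨hjv, h3.write _ _, ?_⟩
      ext j'
      simp [h4]
      grind
  · rintro M₂ ⟨h3, h4⟩
    refine ⟨h3.trans h1, ?_, h4⟩
    rw [h3 bankU (by decide), h2]
    ext i
    have := hS i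
    grind

/-- The state of the search for the root `r` after `c` rounds. -/
def SearchState (n k r : ℕ) (w : ℕ → ℕ → ℕ) (c : ℕ) (M : Mem) : Prop :=
  IsTree (n + k) r w (M bankU) (M bankP) (M bankF) (M bankG) (M bankS) (M bankT) (M bankPrd) c ∧
    M bankTime 0 = c ∧
    (M bankDone 0 = 0 ∧ (∀ j < n + k, M bankT j ≠ 0 → M bankG j ≠ 0) ∨
      M bankDone 0 = 1 ∧ M bankB 0 < n + k ∧ M bankT (M bankB 0) ≠ 0 ∧ M bankG (M bankB 0) = 0)

theorem wp_growTree (hn : M 0 0 = n) (hk : M 0 1 = k) (hs : n + k ≤ s)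
    {r c : ℕ} (hr : M bankRoot 0 = r) (hrn : r < n) (h : SearchState n k r (storedWeight M) c M)
    (hd : M bankDone 0 = 0) :
    Wp s growTree M fun M' => Agree [bankDelta, bankI, bankJ, bankTmp, bankA, bankB, bankU, bankP,
      bankTime, bankT, bankPrd, bankS, bankDone] M' M ∧
      SearchState n k r (storedWeight M) (c + 1) M' := by
  obtain ⟨hT, htime, hdone⟩ := h
  replace hdone := (hdone.resolve_right (by omega)).2
  obtain ⟨j₀, hj₀, hg₀⟩ := hT.assigned.exists_free (by omega)
  have hT₀ : M bankT j₀ = 0 := by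
    by_contra h0
    exact hdone j₀ hj₀ h0 hg₀
  refine wp_seq ((wp_minSlack hn hk hs hr hrn hT.root_mem hj₀ hT₀
    (hT.assigned.free j₀ hj₀ hg₀)).mono ?_)
  rintro M₁ ⟨h1, hA, hB, hTB, hδ, hmin⟩
  have hle : ∀ i, M bankS i ≠ 0 → i < n := fun i hi => by have := hT.le_root i hi; omega
  have hfeas : ∀ i, M bankS i ≠ 0 → ∀ j < n + k,
      storedWeight M i j ≤ M bankU i + M bankP j := by
    intro i hi j hj
    rcases (hT.le_root i hi).eq_or_lt with rfl | hi
    · exact hT.feas_root j hj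
    · exact hT.assigned.feas i hi j hj
  have hgrow := hT.grow (by omega) hdone hA hB hTB
    (δ := M₁ bankDelta 0) (by have := hfeas _ hA _ hB; omega)
    (fun i j hi hj hj' => by
      have := hmin i (hle i hi) j hj hi hj'
      have := hfeas i hi j hj
      omega)
  have e0 := h1 0 (by decide)
  have eS := h1 bankS (by decide)
  refine wp_seq ((wp_updatePrices (by rwa [e0]) (by rwa [e0]) hs (by rwa [eS])).mono ?_)
  rintro M₂ ⟨h2, hU, hP⟩
  rw [eS, h1 bankU (by decide)] at hU
  rw [h1 bankT (by decide), h1 bankP (by decide)] at hP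
  rw [← hU, ← hP] at hgrow
  have h12 := h2.trans h1 (L'' := [bankDelta, bankI, bankJ, bankTmp, bankA, bankB, bankU, bankP])
  have etime := h12 bankTime (by decide)
  have eF := h12 bankF (by decide)
  have eG := h12 bankG (by decide)
  have eS' := h12 bankS (by decide)
  have eT' := h12 bankT (by decide)
  have ePrd := h12 bankPrd (by decide)
  have eA := h2 bankA (by decide)
  have eB := h2 bankB (by decide)
  have edone := h12 bankDone (by decide)
  rw [← eF, ← eG, ← eS', ← eT', ← ePrd, ← eA, ← eB] at hgrow
  rw [← eT', ← eG] at hdone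
  rw [← eB] at hB
  rw [← etime] at htime
  rw [← edone] at hd
  have h3 : Agree [bankDelta, bankI, bankJ, bankTmp, bankA, bankB, bankU, bankP,
      bankTime, bankT, bankPrd, bankS, bankDone] M₂ M := fun b hb => h12 b (by simp at hb ⊢; omega)
  refine wp_seq (wp_set (wp_seq (wp_set (wp_seq (wp_set (wp_ite (fun hg => wp_set ?_)
    fun hg => wp_set ?_))))))
  · simp at hg
    refine ⟨(((h3.write _ _).write _ _).write _ _).write _ _, ?_, by simpa using htime, .inl ?_⟩
    · simpa [hg, htime] using hgrow
    · simp [hd]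
      intro j hj hTj
      rcases eq_or_ne j (M₂ bankB 0) with rfl | hne
      · exact hg
      · exact hdone j hj (by simpa [hne] using hTj)
  · simp at hg
    refine ⟨(((h3.write _ _).write _ _).write _ _).write _ _, ?_, by simpa using htime, .inr ?_⟩
    · simpa [hg, htime] using hgrow
    · simp [hg, hB]

theorem wp_searchTree (hn : M 0 0 = n) (hk : M 0 1 = k) (hs : n + k ≤ s)
    {r : ℕ} (hr : M bankRoot 0 = r) (hrn : r < n) (h : SearchState n k r (storedWeight M) 0 M) :
    Wp s searchTree M fun M' => Agree [bankDelta, bankI, bankJ, bankTmp, bankA, bankB, bankU,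
      bankP, bankTime, bankT, bankPrd, bankS, bankDone] M' M ∧
      M' bankDone 0 = 1 ∧ ∃ c, SearchState n k r (storedWeight M) c M' := by
  refine wp_loop (n + k) hs (fun c M' => Agree [bankDelta, bankI, bankJ, bankTmp, bankA, bankB,
    bankU, bankP, bankTime, bankT, bankPrd, bankS, bankDone] M' M ∧
    SearchState n k r (storedWeight M) c M') ?_ ?_ ?_
  · exact ⟨Agree.refl _ _, h⟩
  · rintro c M' - ⟨h1, h2⟩ he
    simp at he
    have e0 := h1 0 (by decide)
    have hw : storedWeight M' = storedWeight M := by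
      ext i j
      simp [storedWeight, h1 bankW (by decide), e0]
    -- the `c` columns in the tree are assigned, so there are fewer than all
    refine ⟨h2.1.card_lt (by omega) (h2.2.2.resolve_right (by omega)).2, ?_⟩
    refine (wp_growTree (r := r) (by rwa [e0]) (by rwa [e0]) hs (by rwa [h1 bankRoot (by decide)])
      hrn (hw ▸ h2) (by omega)).mono ?_
    rintro M'' ⟨h3, h4⟩
    exact ⟨h3.trans h1, hw ▸ h4⟩
  · rintro c M' - ⟨h1, h2⟩ he
    simp at he
    refine ⟨h1, ?_, c, h2⟩
    have := h2.2.2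
    omega

theorem wp_augment (hs : n + k ≤ s) {r : ℕ} {w : ℕ → ℕ → ℕ}
    (h : IsHole (n + k) r w (M bankU) (M bankP) (M bankF) (M bankG) (M bankT) (M bankPrd)
      (M bankB 0)) (hT : M bankT (M bankB 0) ≤ n + k) :
    Wp s augment M fun M' => Agree [bankA, bankB, bankCur, bankF, bankG] M' M ∧
      IsAssigned (n + k) (r + 1) w (M' bankU) (M' bankP) (M' bankF) (M' bankG) := by
  refine wp_seq (wp_set (wp_loop (n + k) hs (fun c M' =>
    Agree [bankA, bankB, bankCur, bankF, bankG] M' M ∧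
    (M' bankCur 0 ≠ 0 ∧ IsHole (n + k) r w (M' bankU) (M' bankP) (M' bankF) (M' bankG)
      (M' bankT) (M' bankPrd) (M' bankB 0) ∧ M' bankT (M' bankB 0) + c ≤ n + k ∨
    M' bankCur 0 = 0 ∧
      IsAssigned (n + k) (r + 1) w (M' bankU) (M' bankP) (M' bankF) (M' bankG))) ?_ ?_ ?_))
  · exact ⟨(Agree.refl _ _).write _ _, .inl ⟨by simp, by simpa using h, by simpa using hT⟩⟩
  · -- `T` is positive at the hole and decreases, which bounds the number of iterations
    rintro c M' - ⟨h1, h2⟩ he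
    simp at he
    obtain ⟨-, h2, h3⟩ := h2.resolve_right (by omega)
    have := h2.mem
    refine ⟨by omega, wp_seq (wp_set (wp_seq (wp_set (wp_seq (wp_set (wp_seq (wp_set
      (wp_set ?_))))))))⟩
    refine ⟨((((h1.write _ _).write _ _).write _ _).write _ _).write _ _, ?_⟩
    by_cases h0 : M' bankF (M' bankPrd (M' bankB 0)) = 0
    · exact .inr ⟨by simpa using h0, by simpa using h2.isAssigned h0⟩
    · obtain ⟨h4, h5⟩ := h2.next h0
      exact .inl ⟨by simpa using h0, by simpa using h5, by simp; omega⟩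
  · rintro c M' - ⟨h1, h2⟩ he
    simp at he
    exact ⟨h1, (h2.resolve_left (by simp [he])).2⟩

theorem wp_initTree (hn : M 0 0 = n) (hk : M 0 1 = k) (hs : n + k ≤ s)
    {r : ℕ} (hr : M bankRoot 0 = r) {w : ℕ → ℕ → ℕ}
    (h : IsAssigned (n + k) r w (M bankU) (M bankP) (M bankF) (M bankG))
    (hw : ∀ j < n + k, w r j ≤ M bankTot 0) (hS : ∀ i, n ≤ i → M bankS i = 0) :
    Wp s initTree M fun M' =>
      Agree [bankU, bankI, bankJ, bankS, bankT, bankTime, bankDone] M' M ∧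
      SearchState n k r w 0 M' := by
  refine wp_seq (wp_set (wp_seq (wp_for (c := n) (by omega) (fun i M' =>
    Agree [bankI, bankS, bankU] M' M ∧ M' bankU = Function.update (M bankU) r (M bankTot 0) ∧
    M' bankS = fun i' => if i' < i then 0 else M bankS i') ?_ ?_ ?_ ?_)))
  · exact ⟨((Agree.refl _ _).write _ _).write _ _, by simp [hr], by simp⟩
  · rintro i M' ⟨h1, -⟩
    simpa [h1 0 (by decide)] using hn
  · rintro i M' hi ⟨h1, h2, h3⟩ hiv
    refine wp_set ⟨by simpa using hiv, (h1.write _ _).write _ _, by simpa using h2, ?_⟩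
    ext i'
    simp [hiv, h3, Function.update_apply]
    grind
  rintro M₁ ⟨h1, h2, h3⟩
  have e0 := h1 0 (by decide)
  refine wp_seq (wp_for (c := n + k) hs (fun j M' => Agree [bankJ, bankT] M' M₁ ∧
    ∀ j' < j, M' bankT j' = 0) ?_ ?_ ?_ ?_)
  · exact ⟨(Agree.refl _ _).write _ _, by simp⟩
  · rintro j M' ⟨h3, -⟩
    simp [h3 0 (by decide), e0, hn, hk]
  · rintro j M' hj ⟨h4, h5⟩ hjv
    refine wp_set ⟨by simpa using hjv, (h4.write _ _).write _ _, fun j' hj' => ?_⟩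
    have := h5 j'
    simp [hjv, Function.update_apply]
    grind
  rintro M₂ ⟨h4, h5⟩
  have h6 := h4.trans h1 (L'' := [bankU, bankI, bankJ, bankS, bankT, bankTime, bankDone])
  refine wp_seq (wp_set (wp_seq (wp_set (wp_set ⟨((h6.write _ _).write _ _).write _ _, ?_⟩))))
  have h7 : (fun i' => if i' < n then 0 else M bankS i') = fun _ => 0 := by
    ext i
    have := hS i
    grind
  refine ⟨?_, by simp, .inl ⟨by simp, ?_⟩⟩
  · simpa [h4 bankU (by decide), h4 bankS (by decide), h6 bankP (by decide), h6 bankF (by decide),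
      h6 bankG (by decide), h6 bankRoot (by decide), hr, h2, h3, h7] using h.isTree hw h5
  · simpa using fun j hj hT => absurd (h5 j hj) hT

theorem wp_hungarian (hn : M 0 0 = n) (hk : M 0 1 = k) (hs : n + k ≤ s)
    (hP : M bankP = fun _ => 0) (hF : M bankF = fun _ => 0) (hG : M bankG = fun _ => 0)
    (hS : M bankS = fun _ => 0) (hw : ∀ a, M bankW a ≤ M bankTot 0) :
    Wp s hungarian M fun M' => M' 0 = M 0 ∧ M' 1 = M 1 ∧
      ∃ u p, IsAssigned (n + k) n (storedWeight M) u p (M' bankF) (M' bankG) := by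
  let L := [bankRoot, bankDelta, bankI, bankJ, bankTmp, bankA, bankB, bankU,
      bankP, bankTime, bankT, bankPrd, bankS, bankDone, bankCur, bankF, bankG]
  refine wp_for (c := n) (by omega) (fun r M' => Agree L M' M ∧
    IsAssigned (n + k) r (storedWeight M) (M' bankU) (M' bankP) (M' bankF) (M' bankG) ∧
    ∀ i, n ≤ i → M' bankS i = 0) ?_ ?_ ?_ ?_
  · refine ⟨(Agree.refl _ _).write _ _, ?_, by simp [hS]⟩
    constructor <;> simp [hP, hF, hG]
  · rintro r M' ⟨h1, -⟩
    simpa [h1 0 (by decide)] using hn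
  · rintro r M₁ hr ⟨h1, h2, h3⟩ hrv
    have e0 := h1 0 (by decide)
    have eW := h1 bankW (by decide)
    refine wp_seq ((wp_initTree (by rwa [e0]) (by rwa [e0]) hs hrv h2
      (fun j _ => by rw [h1 bankTot (by decide)]; exact hw _) h3).mono ?_)
    rintro M₂ ⟨h4, h5⟩
    have e0' := h4 0 (by decide)
    have eW' := h4 bankW (by decide)
    have hw' : storedWeight M₂ = storedWeight M := by
      ext i j
      simp [storedWeight, e0, e0', eW, eW']
    refine wp_seq ((wp_searchTree (r := r) (by rw [e0', e0, hn]) (by rw [e0', e0, hk]) hs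
      (by rwa [h4 bankRoot (by decide)]) hr (hw' ▸ h5)).mono ?_)
    rintro M₃ ⟨h6, h7, c, h8, -, h9⟩
    obtain ⟨-, h9, h10, h11⟩ := h9.resolve_left (by omega)
    refine (wp_augment hs (h8.isHole h9 h10 h11) ((h8.time_le _ h9).trans h8.card_le)).mono ?_
    rintro M₄ ⟨h12, h13⟩
    refine ⟨?_, ?_, ?_, ?_⟩
    · rw [h12 bankRoot (by decide), h6 bankRoot (by decide), h4 bankRoot (by decide), hrv]
    · refine Agree.write ?_ _ _
      exact (h12.trans h6 (L'' := L)).trans (h4.trans h1 (L'' := L))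
    · simpa [hw'] using h13
    · intro i hi
      simp [h12 bankS (by decide)]
      by_contra h0
      have := h8.le_root i h0
      omega
  · rintro M' ⟨h1, h2, -⟩
    exact ⟨h1 0 (by decide), h1 1 (by decide), _, _, h2⟩

end
end RAM

/-! ### Reading the input -/

namespace SponsoredSearch

/-- The placement with number `x` in the order "no slot, slot `1`, …, slot `k`". -/
def placement (k x : ℕ) : Option (Fin k) :=
  if h : 0 < x ∧ x ≤ k then some ⟨x - 1, by omega⟩ else none

@[simp] theorem placement_zero (k : ℕ) : placement k 0 = none := by simp [placement]

@[simp] theorem placement_val_add_one {k : ℕ} (j : Fin k) : placement k (j + 1) = some j := by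
  simp [placement]

theorem length_words {n k : ℕ} (b : Bid n k) : b.words.length = 2 * k + 5 := by
  simp [Bid.words, ratWords, List.length_flatMap]
  omega

theorem getElem?_flatMap_pair {α β : Type*} (f g : α → β) (l : List α) (x : ℕ) :
    (l.flatMap fun a => [f a, g a])[2 * x]? = l[x]?.map f ∧
      (l.flatMap fun a => [f a, g a])[2 * x + 1]? = l[x]?.map g := by
  induction l generalizing x with
  | nil => simp
  | cons a l ih =>
    cases x with
    | zero => simp
    | succ x => simpa [mul_add] using ih x

theorem words_getD_table {n k : ℕ} (b : Bid n k) {x : ℕ} (hx : x ≤ k) :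
    b.words.getD (2 * x + 3) 0 = (b.table (placement k x)).num ∧
      b.words.getD (2 * x + 4) 0 = (b.table (placement k x)).den := by
  cases x with
  | zero => simp [Bid.words, ratWords]
  | succ x =>
    have h := getElem?_flatMap_pair (fun j => (b.table (some j)).num)
      (fun j => (b.table (some j)).den) (List.finRange k) x
    have h1 : (List.finRange k)[x]? = some ⟨x, hx⟩ := by
      rw [List.getElem?_eq_getElem (by simpa using hx)]
      simp
    have h2 : placement k (x + 1) = some ⟨x, hx⟩ := by
      simpa using placement_val_add_one (⟨x, hx⟩ : Fin k)
    rw [h1] at h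
    simp [Bid.words, ratWords, mul_add, h2, h.1, h.2]

theorem words_getD_zero {n k : ℕ} (b : Bid n k) : b.words.getD 0 0 = b.amount.num := by
  simp [Bid.words, ratWords]

theorem words_getD_one {n k : ℕ} (b : Bid n k) : b.words.getD 1 0 = b.amount.den := by
  simp [Bid.words, ratWords]

theorem words_getD_two {n k : ℕ} (b : Bid n k) : b.words.getD 2 0 = b.label := by
  simp [Bid.words, ratWords]

theorem getD_of_drop_eq {l l₁ l₂ : List ℕ} {a : ℕ} (h : l.drop a = l₁ ++ l₂) {y : ℕ}
    (hy : y < l₁.length) : l.getD (a + y) 0 = l₁.getD y 0 := by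
  have := congrArg (·.getD y 0) h
  simpa [List.getD_eq_getElem?_getD, List.getElem?_append_left hy] using this

/-- The rows of all Bids tables. -/
def Auction.rows (I : Auction) : List (Bid I.n I.k) := (List.finRange I.n).flatMap I.bids

end SponsoredSearch

namespace RAM
open _root_.RAM.Expr _root_.RAM.Prog SponsoredSearch

/-- Store the addresses at which the rows of the Bids tables begin, and their number. -/
def findRows : Prog :=
  .seq (.set bankPos 0 (get 0 1 + 2)) <| .seq (.set bankCnt 0 0) <|
  .for bankI numRows <|
    .seq (.set bankLen 0 (get 0 (reg bankPos))) <| .seq (.set bankPos 0 (reg bankPos + 1)) <|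
    .for bankJ (reg bankLen) <|
      .seq (.set bankRow (reg bankCnt) (reg bankPos)) <|
      .seq (.set bankCnt 0 (reg bankCnt + 1)) <|
      .set bankPos 0 (reg bankPos + (get 0 1 + get 0 1 + 5))

/-- The list `l` of rows has been found: `bankRow` holds the addresses of its members, and `bankCnt`
its length. -/
def Located {n k : ℕ} (l : List (Bid n k)) (M : Mem) : Prop :=
  M bankCnt 0 = l.length ∧ ∀ x (hx : x < l.length), ∀ y < 2 * k + 5,
    M 0 (M bankRow x + y) = l[x].words.getD y 0

theorem Located.congr {n k : ℕ} {l : List (Bid n k)} {M M' : Mem} (h : Located l M)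
    (h0 : M' 0 = M 0) (h1 : M' bankCnt = M bankCnt) (h2 : M' bankRow = M bankRow) :
    Located l M' := by
  simpa [Located, h0, h1, h2] using h

theorem wp_findRows {s : ℕ} {M : Mem} (I : Auction) (hM : ∀ a, M 0 a = I.words.getD a 0)
    (hs : I.words.length ≤ s) :
    Wp s findRows M fun M' => Agree [bankPos, bankCnt, bankI, bankJ, bankLen, bankRow] M' M ∧
      Located I.rows M' := by
  have hn : M 0 0 = I.n := by simp [hM, Auction.words]
  have hk : M 0 1 = I.k := by simp [hM, Auction.words]
  have hlen : I.n + I.k ≤ I.words.length := by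
    simp only [Auction.words, List.length_append, List.length_range, List.length_flatMap,
      List.length_cons, List.sum_map_add]
    simp
    omega
  refine wp_seq (wp_set (wp_seq (wp_set (wp_for (c := I.n) (by omega) (fun i M' =>
    Agree [bankPos, bankCnt, bankI, bankJ, bankLen, bankRow] M' M ∧
    I.words.drop (M' bankPos 0) = ((List.finRange I.n).drop i).flatMap
      (fun i => (I.bids i).length :: (I.bids i).flatMap Bid.words) ∧
    ∃ l, l ++ ((List.finRange I.n).drop i).flatMap I.bids = I.rows ∧ Located l M') ?_ ?_ ?_ ?_))))
  · refine ⟨((Agree.refl _ _).write _ _).write _ _ |>.write _ _, ?_, [], rfl, by simp [Located]⟩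
    simp [hk, Auction.words]
  · rintro i M' ⟨h1, -⟩
    simpa [h1 0 (by decide)] using hn
  · rintro i M₁ hi ⟨h1, h2, l, h3, h4⟩ hiv
    have e0 := h1 0 (by decide)
    set i' : Fin I.n := ⟨i, hi⟩ with hi'
    have hdrop : (List.finRange I.n).drop i = i' :: (List.finRange I.n).drop (i + 1) := by
      rw [List.drop_eq_getElem_cons (by simpa using hi)]
      simp [hi']
    rw [hdrop, List.flatMap_cons] at h2 h3
    have hpos : M 0 (M₁ bankPos 0) = (I.bids i').length := by
      have := getD_of_drop_eq h2 (y := 0) (by simp)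
      simpa [hM] using this
    have hdrop' : I.words.drop (M₁ bankPos 0 + 1) = (I.bids i').flatMap Bid.words ++
        ((List.finRange I.n).drop (i + 1)).flatMap
          (fun i => (I.bids i).length :: (I.bids i).flatMap Bid.words) := by
      rw [← List.drop_drop, h2]
      simp
    have hle : (I.bids i').length ≤ s := by
      have h := congrArg List.length hdrop'
      simp only [List.length_drop, List.length_append, List.length_flatMap (l := I.bids i'),
        length_words, List.map_const', List.sum_replicate, smul_eq_mul] at h
      have : (I.bids i').length * 1 ≤ (I.bids i').length * (2 * I.k + 5) :=
        Nat.mul_le_mul_left _ (by omega)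
      omega
    refine wp_seq (wp_set (wp_seq (wp_set (wp_for (c := (I.bids i').length) hle (fun j M' =>
      Agree [bankPos, bankCnt, bankI, bankJ, bankLen, bankRow] M' M ∧ M' bankI 0 = i ∧
      M' bankLen 0 = (I.bids i').length ∧
      I.words.drop (M' bankPos 0) = ((I.bids i').drop j).flatMap Bid.words ++
        ((List.finRange I.n).drop (i + 1)).flatMap
          (fun i => (I.bids i).length :: (I.bids i).flatMap Bid.words) ∧
      Located (l ++ (I.bids i').take j) M') ?_ ?_ ?_ ?_))))
    · refine ⟨((h1.write _ _).write _ _).write _ _, by simpa using hiv, by simp [e0, hpos],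
        by simpa using hdrop', ?_⟩
      simpa using h4.congr (by simp) (by simp) (by simp)
    · rintro j M' ⟨-, -, h, -⟩
      simpa using h
    · rintro j M' hj ⟨g1, g2, g3, g4, g5, g6⟩ hjv
      have e0' := g1 0 (by decide)
      rw [List.drop_eq_getElem_cons hj, List.flatMap_cons, List.append_assoc] at g4
      refine wp_seq (wp_set (wp_seq (wp_set (wp_set ?_))))
      refine ⟨by simpa using hjv, ((((g1.write _ _).write _ _).write _ _).write _ _),
        by simpa using g2, by simpa using g3, ?_, ?_, ?_⟩
      · have := length_words (I.bids i')[j]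
        simp [e0', hk]
        rw [← List.drop_drop, g4, show I.k + I.k + 5 = (I.bids i')[j].words.length by omega]
        simp
      · simp [g5]
        omega
      · intro x hx y hy
        simp only [List.take_succ_eq_append_getElem hj, ← List.append_assoc] at hx ⊢
        have hx' : x < (l ++ (I.bids i').take j).length ∨ x = (l ++ (I.bids i').take j).length := by
          rw [List.length_append (bs := [_]), List.length_singleton] at hx
          omega
        rcases hx' with hx' | rfl
        · rw [List.getElem_append_left hx', ← g6 x hx' y hy]
          simp [g5]
          simp at hx'
          rw [Function.update_of_ne (by omega)]
        · rw [List.getElem_concat_length rfl]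
          have := getD_of_drop_eq g4 (y := y) (by rw [length_words]; exact hy)
          simp [g5, e0', hM] at this ⊢
          exact this
    · rintro M' ⟨g1, g2, -, g4, g5⟩
      simp only [List.drop_length, List.flatMap_nil, List.nil_append, List.take_length] at g4 g5
      exact ⟨g2, g1.write _ _, by simpa using g4, l ++ I.bids i',
        by simpa using h3, g5.congr (by simp) (by simp) (by simp)⟩
  · rintro M' ⟨h1, -, l, h2, h3⟩
    have : (List.finRange I.n).drop I.n = [] := by simp
    rw [this] at h2
    exact ⟨h1, by simpa [← h2] using h3⟩

end RAM

/-! ### Integer weights -/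

namespace SponsoredSearch

variable {n k : ℕ}

/-- The contribution of a row to the scaled expected revenue, if the advertiser it is labelled with
has the placement with number `x`. The scaling factor `D` is a common denominator. -/
def Bid.term (D : ℕ) (b : Bid n k) (x : ℕ) : ℕ :=
  D / b.amount.den / (b.table (placement k x)).den * b.amount.num * (b.table (placement k x)).num

/-- The contribution of a row to the array of weights, in which address `i * (k + 1) + x` belongs to
advertiser `i` and the placement with number `x`. -/
def Bid.contrib (D : ℕ) (b : Bid n k) (a : ℕ) : ℕ :=
  if b.label * (k + 1) ≤ a ∧ a < b.label * (k + 1) + (k + 1) then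
    b.term D (a - b.label * (k + 1)) else 0

theorem Bid.contrib_apply (D : ℕ) (b : Bid n k) (i : ℕ) {x : ℕ} (hx : x ≤ k) :
    b.contrib D (i * (k + 1) + x) = if b.label = i then b.term D x else 0 := by
  unfold Bid.contrib
  by_cases h : (b.label : ℕ) = i
  · subst h
    simp
    omega
  · rw [if_neg, if_neg h]
    rintro ⟨h1, h2⟩
    rcases lt_or_gt_of_ne h with h | h
    · have := Nat.mul_le_mul_right (k + 1) (Nat.succ_le_of_lt h)
      rw [Nat.succ_mul] at this
      omega
    · have := Nat.mul_le_mul_right (k + 1) (Nat.succ_le_of_lt h)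
      rw [Nat.succ_mul] at this
      omega

/-- `D` is divisible by the denominators of all products "amount times probability" in the row. -/
def Bid.DenDvd (D : ℕ) (b : Bid n k) : Prop :=
  ∀ x ≤ k, b.amount.den * (b.table (placement k x)).den ∣ D

end SponsoredSearch

namespace RAM
open _root_.RAM.Expr _root_.RAM.Prog SponsoredSearch

/-- Compute the product of all denominators. -/
def computeDen : Prog :=
  .seq (.set bankDen 0 1) <| .for bankI (reg bankCnt) <|
    .seq (.set bankPos 0 (get bankRow (reg bankI))) <|
    .seq (.set bankDen 0 (reg bankDen * get 0 (reg bankPos + 1))) <|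
    .for bankJ (get 0 1 + 1) <|
      .set bankDen 0 (reg bankDen * get 0 (reg bankPos + (reg bankJ + reg bankJ + 4)))

/-- The address of the weight to which the current row contributes. -/
abbrev weightAddr : Expr :=
  get 0 (reg bankPos + 2) * get 0 1 + get 0 (reg bankPos + 2) + reg bankJ

/-- Compute the array of weights, and their sum. -/
def computeWeights : Prog :=
  .seq (.set bankTot 0 0) <| .for bankI (reg bankCnt) <|
    .seq (.set bankPos 0 (get bankRow (reg bankI))) <|
    .for bankJ (get 0 1 + 1) <|
      .seq (.set bankTmp 0 (reg bankDen / get 0 (reg bankPos + 1) /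
        get 0 (reg bankPos + (reg bankJ + reg bankJ + 4)) * get 0 (reg bankPos) *
        get 0 (reg bankPos + (reg bankJ + reg bankJ + 3)))) <|
      .seq (.set bankW weightAddr (get bankW weightAddr + reg bankTmp)) <|
      .set bankTot 0 (reg bankTot + reg bankTmp)

section
variable {s n k : ℕ} {M : Mem}

theorem wp_computeDen {l : List (Bid n k)} (hl : Located l M) (hls : l.length ≤ s)
    (hk : M 0 1 = k) (hs : k + 1 ≤ s) :
    Wp s computeDen M fun M' => Agree [bankDen, bankI, bankJ, bankPos] M' M ∧
      0 < M' bankDen 0 ∧ ∀ b ∈ l, b.DenDvd (M' bankDen 0) := by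
  refine wp_seq (wp_set (wp_for (c := l.length) hls (fun r M' =>
    Agree [bankDen, bankI, bankJ, bankPos] M' M ∧
      0 < M' bankDen 0 ∧ ∀ b ∈ l.take r, b.DenDvd (M' bankDen 0)) ?_ ?_ ?_ ?_))
  · exact ⟨((Agree.refl _ _).write _ _).write _ _, by simp, by simp⟩
  · rintro r M' ⟨h1, -⟩
    simpa [h1 bankCnt (by decide)] using hl.1
  · rintro r M₁ hr ⟨h1, h2, h3⟩ hrv
    have e0 := h1 0 (by decide)
    have eR := h1 bankRow (by decide)
    refine wp_seq (wp_set (wp_seq (wp_set (wp_for (c := k + 1) hs (fun x M' =>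
      Agree [bankDen, bankI, bankJ, bankPos] M' M ∧ M' bankI 0 = r ∧ M' bankPos 0 = M bankRow r ∧
      ∃ E, M' bankDen 0 = M₁ bankDen 0 * l[r].amount.den * E ∧ 0 < E ∧
        ∀ y < x, (l[r].table (placement k y)).den ∣ E) ?_ ?_ ?_ ?_))))
    · refine ⟨((h1.write _ _).write _ _).write _ _, by simpa using hrv, by simp [hrv, eR], 1, ?_⟩
      have := hl.2 r hr 1 (by omega)
      rw [words_getD_one] at this
      simp [hrv, eR, e0, this]
    · rintro x M' ⟨g1, -⟩
      simp [g1 0 (by decide), hk]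
    · rintro x M' hx ⟨g1, g2, g3, E, g4, g5, g6⟩ hxv
      have := hl.2 r hr (2 * x + 4) (by omega)
      rw [(words_getD_table _ (by omega)).2, two_mul] at this
      refine wp_set ⟨by simpa using hxv, ((g1.write _ _).write _ _), by simpa using g2,
        by simpa using g3, E * (l[r].table (placement k x)).den, ?_,
        Nat.mul_pos g5 (NNRat.den_pos _), fun y hy => ?_⟩
      · simp [hxv, g3, g1 0 (by decide), this, g4, mul_assoc]
      · rcases Nat.lt_succ_iff_lt_or_eq.1 hy with hy | rfl
        · exact (g6 y hy).mul_right _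
        · exact dvd_mul_left _ _
    · rintro M' ⟨g1, g2, -, E, g4, g5, g6⟩
      refine ⟨g2, g1.write _ _, ?_, ?_⟩
      · rw [Mem.write_of_ne _ _ _ (by decide), g4]
        exact Nat.mul_pos (Nat.mul_pos h2 (NNRat.den_pos _)) g5
      · intro b hb
        rw [Mem.write_of_ne _ _ _ (by decide), g4]
        rw [List.take_succ_eq_append_getElem hr, List.mem_append, List.mem_singleton] at hb
        rcases hb with hb | rfl
        · exact fun x hx => ((h3 b hb x hx).mul_right _).mul_right _
        · exact fun x hx => mul_dvd_mul (dvd_mul_left _ _) (g6 x (by omega))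
  · rintro M' ⟨h1, h2, h3⟩
    exact ⟨h1, h2, by simpa using h3⟩

theorem wp_computeWeights {l : List (Bid n k)} (hl : Located l M) (hls : l.length ≤ s)
    (hk : M 0 1 = k) (hs : k + 1 ≤ s) (hW : M bankW = fun _ => 0) :
    Wp s computeWeights M fun M' => Agree [bankTot, bankI, bankJ, bankPos, bankTmp, bankW] M' M ∧
      (∀ a, M' bankW a ≤ M' bankTot 0) ∧
      M' bankW = fun a => (l.map fun b => b.contrib (M bankDen 0) a).sum := by
  refine wp_seq (wp_set (wp_for (c := l.length) hls (fun r M' =>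
    Agree [bankTot, bankI, bankJ, bankPos, bankTmp, bankW] M' M ∧
      (∀ a, M' bankW a ≤ M' bankTot 0) ∧
      M' bankW = fun a => ((l.take r).map fun b => b.contrib (M bankDen 0) a).sum) ?_ ?_ ?_ ?_))
  · exact ⟨((Agree.refl _ _).write _ _).write _ _, by simp [hW], by simp [hW]⟩
  · rintro r M' ⟨h1, -⟩
    simpa [h1 bankCnt (by decide)] using hl.1
  · rintro r M₁ hr ⟨h1, h2, h3⟩ hrv
    have eR := h1 bankRow (by decide)
    refine wp_seq (wp_set (wp_for (c := k + 1) hs (fun x M' =>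
      Agree [bankTot, bankI, bankJ, bankPos, bankTmp, bankW] M' M ∧ M' bankI 0 = r ∧
      M' bankPos 0 = M bankRow r ∧ (∀ a, M' bankW a ≤ M' bankTot 0) ∧
      M' bankW = fun a => ((l.take r).map fun b => b.contrib (M bankDen 0) a).sum +
        if l[r].label * (k + 1) ≤ a ∧ a < l[r].label * (k + 1) + x then
          l[r].contrib (M bankDen 0) a else 0) ?_ ?_ ?_ ?_))
    · refine ⟨(h1.write _ _).write _ _, by simpa using hrv, by simp [hrv, eR], by simpa using h2, ?_⟩
      ext a
      simp [h3]
    · rintro x M' ⟨g1, -⟩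
      simp [g1 0 (by decide), hk]
    · rintro x M' hx ⟨g1, g2, g3, g4, g5⟩ hxv
      have e0 := g1 0 (by decide)
      have w0 := hl.2 r hr 0 (by omega)
      have w1 := hl.2 r hr 1 (by omega)
      have w2 := hl.2 r hr 2 (by omega)
      have w3 := hl.2 r hr (2 * x + 3) (by omega)
      have w4 := hl.2 r hr (2 * x + 4) (by omega)
      rw [words_getD_zero, add_zero] at w0
      rw [words_getD_one] at w1
      rw [words_getD_two] at w2
      rw [(words_getD_table _ (by omega)).1, two_mul] at w3
      rw [(words_getD_table _ (by omega)).2, two_mul] at w4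
      set a₀ : ℕ := l[r].label * (k + 1) + x with ha₀
      have ha₀' : (l[r].label * k + l[r].label + x : ℕ) = a₀ := by rw [ha₀]; ring
      set t := l[r].term (M bankDen 0) x with ht
      have ht' : l[r].contrib (M bankDen 0) a₀ = t := by
        rw [ha₀, Bid.contrib_apply _ _ _ (by omega), if_pos rfl]
      have htmp : (reg bankDen / get 0 (reg bankPos + 1) /
          get 0 (reg bankPos + (reg bankJ + reg bankJ + 4)) * get 0 (reg bankPos) *
          get 0 (reg bankPos + (reg bankJ + reg bankJ + 3))).val M' = t := by
        simp [g3, e0, w0, w1, w3, w4, hxv, g1 bankDen (by decide), ht, Bid.term]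
      refine wp_seq (wp_set (wp_seq (wp_set (wp_set ?_))))
      rw [htmp]
      refine ⟨by simpa using hxv, (((g1.write _ _).write _ _).write _ _).write _ _,
        by simpa using g2, by simpa using g3, fun a => ?_, ?_⟩
      · simp only [val_add, val_mul, val_get, val_ofNat, Mem.write_same, ne_eq,
          Nat.reduceEqDiff, not_false_eq_true, Mem.write_of_ne, Function.update_apply, if_true]
        have := g4 a
        split_ifs with h
        · rw [← h]
          omega
        · omega
      · ext a
        simp [g3, e0, w2, hk, hxv, ha₀', g5, Function.update_apply]
        by_cases h : a = a₀
        · rw [if_pos h, if_pos (by omega), h, ht']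
        · rw [if_neg h]
          congr 1
          simp only [show (a < l[r].label * (k + 1) + (x + 1) ↔ a < l[r].label * (k + 1) + x) by
            omega]
          rw [ha₀]
    · rintro M' ⟨g1, g2, -, g4, g5⟩
      refine ⟨g2, g1.write _ _, by simpa using g4, ?_⟩
      ext a
      rw [Mem.write_of_ne _ _ _ (by decide), g5, List.take_succ_eq_append_getElem hr]
      simp only [List.map_append, List.sum_append, List.map_singleton, List.sum_singleton]
      rw [Bid.contrib]
      grind
  · rintro M' ⟨h1, h2, h3⟩
    exact ⟨h1, h2, by simpa using h3⟩

end
end RAM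

/-! ### The expected revenue -/

namespace SponsoredSearch

variable {n k : ℕ}

/-- The number of a placement, in the order "no slot, slot `1`, …, slot `k`". -/
def placementNum : Option (Fin k) → ℕ
  | none => 0
  | some j => j + 1

theorem placementNum_le (o : Option (Fin k)) : placementNum o ≤ k := by
  cases o with
  | none => exact Nat.zero_le _
  | some j => exact j.isLt

@[simp] theorem placement_placementNum (o : Option (Fin k)) :
    placement k (placementNum o) = o := by
  cases o <;> simp [placementNum]

theorem onlyPlace_apply_self (i : Fin n) (o : Option (Fin k)) : onlyPlace i o i = o := by
  cases o <;> simp [onlyPlace]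

theorem prob_eq_sum (μ : OutcomeModel n k) (A : Allocation n k) (E : Set (Outcome n k)) :
    prob μ A E = ∑ r : Response n, (μ A r).toReal * E.indicator (fun _ => (1 : ℝ)) (A, r) := by
  rw [prob, PMF.toOuterMeasure_apply_fintype, ENNReal.toReal_sum]
  · refine Finset.sum_congr rfl fun r _ => ?_
    by_cases h : (A, r) ∈ E <;> simp [h]
  · intro r _
    by_cases h : (A, r) ∈ E <;> simp [h, PMF.apply_ne_top]

theorem Bid.IsValid.prob_eq {μ : OutcomeModel n k} {b : Bid n k} (h : b.IsValid μ)
    (A : Allocation n k) : prob μ A b.event = (b.table (A b.label) : ℝ) := by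
  rw [h.table_eq]
  refine h.dependsOnlyOn _ _ fun i hi => ?_
  rw [Finset.mem_singleton.1 hi, onlyPlace_apply_self]

theorem Bid.cast_term {D : ℕ} {b : Bid n k} (h : b.DenDvd D) {x : ℕ} (hx : x ≤ k) :
    (b.term D x : ℝ) = D * (b.amount * (b.table (placement k x) : ℝ)) := by
  have h1 : (b.amount.den : ℝ) ≠ 0 := by simp
  have h2 : ((b.table (placement k x)).den : ℝ) ≠ 0 := by simp
  rw [Bid.term, Nat.div_div_eq_div_mul]
  push_cast [Nat.cast_div (h x hx) (by push_cast; exact mul_ne_zero h1 h2)]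
  rw [NNRat.cast_def b.amount, NNRat.cast_def (b.table _)]
  field_simp

theorem sum_flatMap_finRange {α : Type*} (f : Fin n → List α) (g : α → ℝ) :
    (((List.finRange n).flatMap f).map g).sum = ∑ i, ((f i).map g).sum := by
  rw [Fin.sum_univ_def]
  generalize List.finRange n = l
  induction l with
  | nil => simp
  | cons a l ih => simp [ih]

theorem Auction.expectedRevenue_eq (I : Auction) (A : Allocation I.n I.k) :
    I.expectedRevenue A = (I.rows.map fun b => (b.amount : ℝ) * prob I.model A b.event).sum := by
  simp only [expectedRevenue, revenue, ← sum_flatMap_finRange I.bids]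
  rw [← Auction.rows]
  generalize I.rows = l
  induction l with
  | nil => simp
  | cons b l ih =>
    simp only [List.map_cons, List.sum_cons, mul_add, Finset.sum_add_distrib, ih]
    congr 1
    rw [prob_eq_sum, Finset.mul_sum]
    refine Finset.sum_congr rfl fun r _ => ?_
    by_cases h : (A, r) ∈ b.event <;> simp [h, mul_comm]

/-- The array of integer weights that belongs to the common denominator `D`. -/
def Auction.weights (I : Auction) (D a : ℕ) : ℕ := (I.rows.map fun b => b.contrib D a).sum

/-- The scaled expected revenue is the sum of the weights of the placements. -/
theorem Auction.mul_expectedRevenue (I : Auction) {D : ℕ} (hD : ∀ b ∈ I.rows, b.DenDvd D)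
    (A : Allocation I.n I.k) :
    D * I.expectedRevenue A =
      ((∑ i : Fin I.n, I.weights D (i * (I.k + 1) + placementNum (A i)) : ℕ) : ℝ) := by
  have hvalid : ∀ b ∈ I.rows, b.IsValid I.model := by
    intro b hb
    obtain ⟨i, -, hi⟩ := List.mem_flatMap.1 hb
    exact I.valid i b hi
  rw [I.expectedRevenue_eq]
  simp only [Auction.weights]
  generalize I.rows = l at *
  induction l with
  | nil => simp
  | cons b l ih =>
    rw [List.forall_mem_cons] at hD hvalid
    simp only [List.map_cons, List.sum_cons, Finset.sum_add_distrib, mul_add (D : ℝ),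
      Nat.cast_add, ih hD.2 hvalid.2]
    congr 1
    simp only [b.contrib_apply D _ (placementNum_le _), Fin.val_inj]
    rw [Finset.sum_ite_eq, if_pos (Finset.mem_univ _), Bid.cast_term hD.1 (placementNum_le _),
      hvalid.1.prob_eq, placement_placementNum]

end SponsoredSearch

/-! ### The algorithm -/

namespace Hungarian

/-- The allocation that belongs to an assignment of the advertisers to the columns, of which the
first `n` are dummies. -/
theorem IsAssigned.exists_allocation {n k : ℕ} {w : ℕ → ℕ → ℕ} {u p f g : ℕ → ℕ}
    (h : IsAssigned (n + k) n w u p f g) : ∃ A : SponsoredSearch.Allocation n k,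
      (∀ i : Fin n, SponsoredSearch.placementNum (A i) = f i - n) ∧
      ∀ j : Fin k, g (n + j) = match A.symm j with
        | none => 0
        | some i => i.val + 1 := by
  have hrow : ∀ i : Fin n, f i ≤ n + k := fun i => by
    obtain ⟨j, hj, h1, -⟩ := h.row i i.isLt
    omega
  have hcol : ∀ j : Fin k, g (n + j) ≤ n := fun j => by
    by_contra h0
    have := (h.col (n + j) (by omega) (g (n + j) - 1) (by omega)).1
    omega
  have hiff : ∀ (i : Fin n) (j : Fin k), f i = n + j + 1 ↔ g (n + j) = i + 1 := by
    intro i j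
    constructor
    · intro hf
      obtain ⟨j', -, h1, h2, -⟩ := h.row i i.isLt
      rw [← h2]
      congr 1
      omega
    · exact fun hg => (h.col (n + j) (by omega) i hg).2
  let F (i : Fin n) : Option (Fin k) := if hi : n < f i then some ⟨f i - n - 1, by
    have := hrow i; omega⟩ else none
  let G (j : Fin k) : Option (Fin n) := if hj : 0 < g (n + j) then some ⟨g (n + j) - 1, by
    have := hcol j; omega⟩ else none
  have hF : ∀ i j, j ∈ F i ↔ f i = n + j + 1 := by
    intro i j
    simp only [F, Option.mem_def]
    split_ifs with hi
    · rw [Option.some_inj, Fin.ext_iff]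
      simp only
      omega
    · simp
      omega
  have hG : ∀ i j, i ∈ G j ↔ g (n + j) = i + 1 := by
    intro i j
    simp only [G, Option.mem_def]
    split_ifs with hj
    · rw [Option.some_inj, Fin.ext_iff]
      simp only
      omega
    · simp
      omega
  refine ⟨⟨F, G, fun i j => (hG i j).trans ((hiff i j).symm.trans (hF i j).symm)⟩,
    fun i => ?_, fun j => ?_⟩
  · change SponsoredSearch.placementNum (F i) = _
    simp only [F]
    split_ifs with hi
    · simp only [SponsoredSearch.placementNum]
      omega
    · simp only [SponsoredSearch.placementNum]
      omega
  · change _ = match G j with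
      | none => 0
      | some i => i.val + 1
    simp only [G]
    split_ifs with hj
    · simp only
      omega
    · simpa using hj

end Hungarian

namespace RAM
open _root_.RAM.Expr _root_.RAM.Prog SponsoredSearch

/-- Write the allocation to the output bank. -/
def writeOutput : Prog :=
  .for bankJ (get 0 1) (.set 1 (reg bankJ) (get bankG (reg bankJ + get 0 0)))

/-- The algorithm for winner determination. -/
def winnerDetermination : Prog :=
  .seq findRows <| .seq computeDen <| .seq computeWeights <| .seq hungarian writeOutput

theorem wp_writeOutput {s n k : ℕ} {M : Mem} (hn : M 0 0 = n) (hk : M 0 1 = k) (hs : k ≤ s) :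
    Wp s writeOutput M fun M' => ∀ j < k, M' 1 j = M bankG (n + j) := by
  refine wp_for (c := k) hs (fun j M' => Agree [bankJ, 1] M' M ∧
    ∀ j' < j, M' 1 j' = M bankG (n + j')) ?_ ?_ ?_ ?_
  · exact ⟨(Agree.refl _ _).write _ _, by simp⟩
  · rintro j M' ⟨h1, -⟩
    simpa [h1 0 (by decide)] using hk
  · rintro j M' hj ⟨h1, h2⟩ hjv
    refine wp_set ⟨by simpa using hjv, (h1.write _ _).write _ _, fun j' hj' => ?_⟩
    simp only [val_add, val_get, val_ofNat, Mem.write_same, ne_eq,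
      not_false_eq_true, Mem.write_of_ne, hjv, h1 0 (by decide), hn,
      h1 bankG (by decide), Function.update_apply, OfNat.one_ne_ofNat]
    split_ifs with h
    · rw [h, add_comm]
    · exact h2 j' (by omega)
  · rintro M' ⟨-, h⟩
    exact h

theorem wp_winnerDetermination {s : ℕ} (I : Auction) (hs : I.words.length ≤ s) :
    Wp s winnerDetermination (initMem I.words) fun M => I.IsSolution (M 1) := by
  have hlen : I.n + I.k + 2 ≤ I.words.length ∧ I.rows.length ≤ I.words.length := by
    have : ∀ i, (I.bids i).length ≤ (I.bids i).length * (2 * I.k + 5) := fun i =>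
      Nat.le_mul_of_pos_right _ (by omega)
    have := Finset.sum_le_sum fun i (_ : i ∈ Finset.univ) => this i
    simp only [Auction.words, Auction.rows, List.length_append, List.length_range,
      List.length_flatMap, List.length_cons, length_words, List.map_const', List.sum_replicate,
      smul_eq_mul, ← Fin.sum_univ_def, Finset.sum_add_distrib] at this ⊢
    simp
    omega
  have hn : initMem I.words 0 0 = I.n := by simp [initMem, Auction.words]
  have hk : initMem I.words 0 1 = I.k := by simp [initMem, Auction.words]
  have hz : ∀ b, b ≠ 0 → initMem I.words b = fun _ => 0 := fun b hb => by
    ext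
    simp [initMem, hb]
  refine wp_seq ((wp_findRows I (by simp [initMem]) hs).mono ?_)
  rintro M₁ ⟨h1, hl₁⟩
  have e1 := h1 0 (by decide)
  refine wp_seq ((wp_computeDen hl₁ (by omega) (by rwa [e1]) (by omega)).mono ?_)
  rintro M₂ ⟨h2, hpos, hdvd⟩
  have e2 := (h2 0 (by decide)).trans e1
  have hl₂ := hl₁.congr (h2 0 (by decide)) (h2 bankCnt (by decide)) (h2 bankRow (by decide))
  refine wp_seq ((wp_computeWeights hl₂ (by omega) (by rwa [e2]) (by omega) (by
    rw [h2 bankW (by decide), h1 bankW (by decide)]; exact hz _ (by decide))).mono ?_)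
  rintro M₃ ⟨h3, htot, hW⟩
  have e3 := (h3 0 (by decide)).trans e2
  have hz₃ : ∀ b, b ∉ [bankTot, bankI, bankJ, bankPos, bankTmp, bankW, bankDen, bankCnt, bankLen,
      bankRow, 0] → M₃ b = fun _ => 0 := by
    intro b hb
    simp at hb
    rw [h3 b (by simp; omega), h2 b (by simp; omega), h1 b (by simp; omega)]
    exact hz b (by omega)
  refine wp_seq ((wp_hungarian (n := I.n) (k := I.k) (by rwa [e3]) (by rwa [e3]) (by omega)
    (hz₃ _ (by decide)) (hz₃ _ (by decide)) (hz₃ _ (by decide)) (hz₃ _ (by decide)) htot).mono ?_)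
  rintro M₄ ⟨h4, -, u, p, hA⟩
  refine (wp_writeOutput (n := I.n) (k := I.k) (by rw [h4, e3, hn]) (by rw [h4, e3, hk])
    (by omega)).mono ?_
  intro M₅ h5
  obtain ⟨A, hA₁, hA₂⟩ := hA.exists_allocation
  refine ⟨A, fun j => (h5 j j.isLt).trans
    ((hA₂ j).trans (by cases A.symm j <;> rfl)), fun B => ?_⟩
  have hw : ∀ i j, storedWeight M₃ i j =
      I.weights (M₂ bankDen 0) (i * (I.k + 1) + (j + 1 - I.n)) := by
    intro i j
    rw [storedWeight, e3, hn, hk, hW, Auction.weights]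
    congr 2
  -- the assignment of the advertisers to the columns that belongs to `B`; an advertiser without a
  -- slot gets the dummy column of the same number, which makes `τ` injective
  let τ (i : Fin I.n) : ℕ := (B i).elim i fun j => I.n + j
  have hτ : ∀ i, τ i < I.n + I.k ∧ τ i + 1 - I.n = placementNum (B i) := by
    intro i
    simp only [τ]
    cases B i <;> simp [placementNum] <;> omega
  have hτinj : ∀ i j, τ i = τ j → i = j := by
    intro i j hij
    simp only [τ] at hij
    cases hi : B i with
    | none =>
      cases hj : B j with
      | none => simpa [hi, hj, Fin.ext_iff] using hij
      | some b => simp [hi, hj] at hij; omega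
    | some a =>
      cases hj : B j with
      | none => simp [hi, hj] at hij; omega
      | some b =>
        simp [hi, hj] at hij
        exact B.inj (b := a) (by simp [hi]) (by simp [hj, Fin.ext_iff, hij])
  have hopt := hA.optimal (fun i => if h : i < I.n then τ ⟨i, h⟩ else 0)
    (fun i hi => by simpa [hi] using (hτ ⟨i, hi⟩).1)
    (fun i hi j hj hij => by simpa using hτinj ⟨i, hi⟩ ⟨j, hj⟩ (by simpa [hi, hj] using hij))
  rw [Finset.sum_range, Finset.sum_range] at hopt
  simp only [hw, Fin.is_lt, dite_true, Fin.eta, (hτ _).2] at hopt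
  have hA₃ : ∀ i : Fin I.n, M₄ bankF i - 1 + 1 - I.n = placementNum (A i) := by
    intro i
    obtain ⟨j, -, h, -⟩ := hA.row i i.isLt
    rw [hA₁, h, Nat.add_sub_cancel]
  simp only [hA₃] at hopt
  have hD : (0 : ℝ) < M₂ bankDen 0 := by exact_mod_cast hpos
  refine le_of_mul_le_mul_left ?_ hD
  rw [I.mul_expectedRevenue hdvd, I.mul_expectedRevenue hdvd]
  exact_mod_cast hopt

theorem winnerDetermination_tame : winnerDetermination.tame = true := by decide

theorem length_le_bitSize (l : List ℕ) : l.length ≤ bitSize l := by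
  induction l with
  | nil => simp
  | cons a l ih =>
    simp only [bitSize, List.map_cons, List.sum_cons, List.length_cons] at *
    omega

theorem getD_lt_two_pow_bitSize (l : List ℕ) (a : ℕ) : l.getD a 0 < 2 ^ bitSize l := by
  rw [List.getD_eq_getElem?_getD]
  by_cases h : a < l.length
  · rw [List.getElem?_eq_getElem h, Option.getD_some, ← Nat.size_le]
    have := List.single_le_sum (l := l.map fun x => 1 + Nat.size x) (by simp) (1 + Nat.size l[a])
      (List.mem_map.2 ⟨_, List.getElem_mem h, rfl⟩)
    simp only [bitSize]
    omega
  · simp [List.getElem?_eq_none (not_lt.1 h)]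

end RAM

theorem theorem1 :
    RAM.SolvableInPolyTime SponsoredSearch.Auction.words SponsoredSearch.Auction.IsSolution := by
  obtain ⟨G, hG⟩ := RAM.Exec.exists_run _ RAM.winnerDetermination_tame
  obtain ⟨C, hC⟩ := hG .X
  refine ⟨RAM.winnerDetermination, C, fun I => ?_⟩
  have hlen := RAM.length_le_bitSize I.words
  obtain ⟨M, hM, hsol⟩ := RAM.wp_winnerDetermination I hlen
  have h0 : ∀ a, RAM.initMem I.words 0 a < 2 ^ RAM.bitSize I.words :=
    fun a => by simpa [RAM.initMem] using RAM.getD_lt_two_pow_bitSize I.words a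
  obtain ⟨⟨t, ht, hrun⟩, -⟩ := hC (RAM.bitSize I.words) _ M (by
      refine le_trans ?_ hlen
      simp [SponsoredSearch.Auction.words]) hM (fun b a => by
      rw [Polynomial.eval_X]
      by_cases hb : b = 0
      · exact hb ▸ h0 a
      · simp [RAM.initMem, hb]) h0
  exact ⟨M, t, hrun, ht, hsol⟩
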